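/- **Setting.** Let $X\subseteq\mathbb R^d$ with $\overline X=\overline{\operatorname{int}X}$, let $Y\subseteq\mathbb R$, and let $\rho$ be a probability measure on $X\times Y$ with marginal $\rho_X$ on $X$. Let $H$ be a reproducing kernel Hilbert space of real functions on $X$ with kernel $k$, and write $k_x=k(x,\cdot)$. Partial derivatives of functions on $X$ are taken in the interior of $X$ and extended by continuity to $X$. Put $(\partial_a k)_x:=\left.\frac{\partial k(s,\cdot)}{\partial s^a}\right|_{s=x}$. Assume: * (A1) $\sup_{x\in X}\|k_x\|_H\le\kappa<\infty$; * (A2) $k$ is $C^2$ on $X\times X$ (it is continuous there, $C^2$ in the interior, and its derivatives of order at most $2$ extend continuously to $X\times X$), and $\sup_{x\in X}\|(\partial_ak)_x\|_H\le\kappa'<\infty$ for $a=1,\dots,d$; * (A3) $Y\subseteq[-M,M]$ for some $0<M<\infty$. Fix $\nu>0$ and $c\in\{1,2\}$ (both normalizations of the penalty are covered). For $f\in H$ and a sample $z=(x_i,y_i)_{i=1}^n$ drawn from $\rho^n$, let $$\mathcal E(f)=\int (y-f(x))^2\,d\rho(x,y),\qquad \Omega^D_1(f)=\sum_{a=1}^d\Big(\int_X\Big(\frac{\partial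 f}{\partial x^a}\Big)^2d\rho_X\Big)^{1/2},$$ $$\widehat{\mathcal E}(f)=\frac1n\sum_{i=1}^n(y_i-f(x_i))^2,\qquad \widehat\Omega^D_1(f)=\sum_{a=1}^d\Big(\frac1n\sum_{i=1}^n\Big(\frac{\partial f}{\partial x^a}(x_i)\Big)^2\Big)^{1/2}.$$ For $\tau>0$ let $f^\tau$ and $\hat f^\tau$ be the minimizers over $H$ of $$\mathcal E(f)+\tau\big(c\,\Omega^D_1(f)+\nu\|f\|_H^2\big)\quad\text{and}\quad \widehat{\mathcal E}(f)+\tau\big(c\,\widehat\Omega^D_1(f)+\nu\|f\|_H^2\big),$$ respectively. Assume that the set $\mathcal F_H$ of minimizers of $\mathcal E$ over $H$ is not empty, and let $f^\dagger_\rho$ be the minimizer of $c\,\Omega^D_1+\nu\|\cdot\|_H^2$ over $\mathcal F_H$. **Theorem.** The minimizers $f^\dagger_\rho$, $f^\tau$ and $\hat f^\tau$ exist and are unique. Moreover: 1. For all $n\ge1$, $\tau>0$ and $0<\eta\le1$, $$\mathbb P\Big(\|\hat f^\tau-f^\dagger_\rho\|_H\ \ge\ A(n,\tau)^{1/2}\sqrt{\log\tfrac{6+2d}{\eta}}+\|f^\tau-f^\dagger_\rho\|_H\Big)<\eta,$$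 where $$A(n,\tau)=4\sqrt2\,M\left(\frac{4\kappa^2M}{\sqrt n\,\tau^2\nu^2}+\frac{4\kappa}{\sqrt n\,\tau\nu\sqrt{\tau\nu}}+\frac1{\sqrt n\,\tau\nu}+\frac{2d\kappa'}{n^{1/4}\nu\sqrt{\tau\nu}}\right).$$ 2. If $\tau_n>0$, $\tau_n\to0$ and $(\sqrt n\,\tau_n^2)^{-1}\to0$ as $n\to\infty$, then $$\lim_{n\to\infty}\mathbb P\big(\|\hat f^{\tau_n}-f^\dagger_\rho\|_H\ge\varepsilon\big)=0\qquad\text{for all }\varepsilon>0.$$ -/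

import Mathlib

open Filter MeasureTheory Set
open scoped Topology

noncomputable section

namespace DerivReg

/-- `F` is of class `C^n` on a set `S` (typically contained in the closure of its interior): `F` is
continuous on `S`, `C^n` on the interior of `S`, and all its derivatives of order at most `n` on the
interior extend continuously to `S`. -/
def IsCnOn {V : Type*} [NormedAddCommGroup V] [NormedSpace ℝ V]
    (n : ℕ) (F : V → ℝ) (S : Set V) : Prop :=
  ContinuousOn F S ∧ ContDiffOn ℝ n F (interior S) ∧
    ∀ m : ℕ, m ≤ n → ∃ G : V → V [×m]→L[ℝ] ℝ,
      ContinuousOn G S ∧ EqOn (iteratedFDeriv ℝ m F) G (interior S)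

/-- The partial derivative `∂f/∂x^a` of `f : X → ℝ`, as a function on `X`: the usual partial
derivative on the interior of `X`, extended by continuity to the other points of `X`. -/
def pderiv {d : ℕ} {X : Set (EuclideanSpace ℝ (Fin d))} (a : Fin d) (f : X → ℝ) (x : X) : ℝ :=
  extendFrom (interior X)
    (fun y => lineDeriv ℝ (Function.extend Subtype.val f 0) y (EuclideanSpace.single a 1)) x

section Kernel

variable {d : ℕ} {X : Set (EuclideanSpace ℝ (Fin d))}
  (H : Type*) [NormedAddCommGroup H] [InnerProductSpace ℝ H] [CompleteSpace H] [RKHS ℝ H X ℝ]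

/-- The function `k_x = k(x, ·)`, as an element of `H`. -/
def kfun (x : X) : H := RKHS.kerFun H x (1 : ℝ)

/-- The reproducing kernel `k : X × X → ℝ` of `H`. -/
def ker (s t : X) : ℝ := kfun H s t

/-- The kernel `k` is of class `C^2` on `X × X`. -/
def KernelC2 : Prop :=
  IsCnOn 2
    (Function.extend (Prod.map Subtype.val Subtype.val) (fun p : X × X => ker H p.1 p.2) 0 :
      EuclideanSpace ℝ (Fin d) × EuclideanSpace ℝ (Fin d) → ℝ)
    (X ×ˢ X)

variable {H} in
/-- `g ∈ H` is the function `(∂_a k)_x : t ↦ ∂k(s, t)/∂s^a` at `s = x`. -/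
def IsKernelDeriv (a : Fin d) (x : X) (g : H) : Prop :=
  ∀ t : X, g t = pderiv a (fun s => ker H s t) x

end Kernel

section Functionals

variable {d : ℕ} {X : Set (EuclideanSpace ℝ (Fin d))} {Y : Set ℝ}

/-- The expected risk `∫ (y - f(x))² dρ(x, y)`. -/
def risk (ρ : Measure (X × Y)) (f : X → ℝ) : ℝ :=
  ∫ p, ((p.2 : ℝ) - f p.1) ^ 2 ∂ρ

/-- The penalty `Ω(f) = ∑_a ‖∂f/∂x^a‖_{L²(μ)}`. -/
def penalty (μ : Measure X) (f : X → ℝ) : ℝ :=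
  ∑ a : Fin d, √(∫ x, (pderiv a f x) ^ 2 ∂μ)

/-- The empirical risk `(1/n) ∑_i (y_i - f(x_i))²`. -/
def empRisk {n : ℕ} (z : Fin n → X × Y) (f : X → ℝ) : ℝ :=
  (1 / (n : ℝ)) * ∑ i, (((z i).2 : ℝ) - f (z i).1) ^ 2

/-- The empirical penalty `∑_a ((1/n) ∑_i (∂f/∂x^a(x_i))²)^{1/2}`. -/
def empPenalty {n : ℕ} (z : Fin n → X × Y) (f : X → ℝ) : ℝ :=
  ∑ a : Fin d, √((1 / (n : ℝ)) * ∑ i, (pderiv a f (z i).1) ^ 2)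

end Functionals

/-- The set of minimizers of `F` over `S`. -/
def minimizers {H : Type*} (F : H → ℝ) (S : Set H) : Set H :=
  {f | f ∈ S ∧ ∀ g ∈ S, F f ≤ F g}

/-- A minimizer of `F` over `S` (an arbitrary point if there is none). -/
def argmin {H : Type*} [Nonempty H] (F : H → ℝ) (S : Set H) : H :=
  Classical.epsilon fun f => f ∈ minimizers F S

section Estimators

variable {d : ℕ} {X : Set (EuclideanSpace ℝ (Fin d))} {Y : Set ℝ}
  (H : Type*) [NormedAddCommGroup H] [InnerProductSpace ℝ H] [RKHS ℝ H X ℝ]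

/-- The functional `c Ω(f) + ν ‖f‖²` on `H`, where `Ω` is taken in `L²` of the marginal of `ρ`. -/
def regularizer (ρ : Measure (X × Y)) (c ν : ℝ) (f : H) : ℝ :=
  c * penalty ρ.fst f + ν * ‖f‖ ^ 2

/-- The regularized expected risk `∫ (y - f(x))² dρ + τ (c Ω(f) + ν ‖f‖²)` on `H`. -/
def regRisk (ρ : Measure (X × Y)) (c ν τ : ℝ) (f : H) : ℝ :=
  risk ρ f + τ * (c * penalty ρ.fst f + ν * ‖f‖ ^ 2)

/-- The regularized empirical risk on `H`. -/
def regEmpRisk {n : ℕ} (z : Fin n → X × Y) (c ν τ : ℝ) (f : H) : ℝ :=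
  empRisk z f + τ * (c * empPenalty z f + ν * ‖f‖ ^ 2)

/-- The set of risk minimizers in `H`. -/
def riskMinimizers (ρ : Measure (X × Y)) : Set H :=
  minimizers (fun f : H => risk ρ f) univ

/-- The target `f†`: the minimizer of `c Ω + ν ‖·‖²` over the set of risk minimizers. -/
def fDagger (ρ : Measure (X × Y)) (c ν : ℝ) : H :=
  argmin (regularizer H ρ c ν) (riskMinimizers H ρ)

/-- `f^τ`, the minimizer over `H` of the regularized expected risk. -/
def fReg (ρ : Measure (X × Y)) (c ν τ : ℝ) : H :=
  argmin (regRisk H ρ c ν τ) univ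

/-- The regularized estimator: the minimizer over `H` of the regularized empirical risk. -/
def fHat {n : ℕ} (z : Fin n → X × Y) (c ν τ : ℝ) : H :=
  argmin (regEmpRisk H z c ν τ) univ

end Estimators

/-- The quantity `A(n, τ)`. -/
def boundA (d : ℕ) (κ κ' M ν : ℝ) (n : ℕ) (τ : ℝ) : ℝ :=
  4 * √2 * M *
    (4 * κ ^ 2 * M / (√n * τ ^ 2 * ν ^ 2)
      + 4 * κ / (√n * (τ * ν) * √(τ * ν))
      + 1 / (√n * (τ * ν))
      + 2 * d * κ' / ((n : ℝ) ^ (1 / 4 : ℝ) * ν * √(τ * ν)))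

end DerivReg

end

open DerivReg

/-! Because `k` is `C^2`, both `f ↦ f x` and `f ↦ ∂f/∂x^a (x)` are inner products with vectors of
`H` that are bounded and depend continuously on `x` (`exists_pderiv_representer`). The risk and the
penalty of a measure therefore depend on that measure only through `∫ y²`, the vector `∫ y k_x` and
the second moments `∫ g ⊗ g`, for `g` equal to `k_x` or to a derivative representer. The empirical
problem is the population problem for the empirical measure, so `f^τ` and `f̂^τ` are the same
construction applied to two measures.

Each regularized functional is a convex function plus `τν‖f‖²`, so it grows quadratically away from
its minimizer. This gives existence and uniqueness. Adding the growth inequalities of the two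
problems bounds the squared distance of their minimizers by the distances of the moments
(`norm_sub_sq_le`). The moments of the sample are means of bounded i.i.d. Hilbert space vectors, so
Hoeffding's inequality in Hilbert space (`measure_norm_mean_sub_integral_gt_le`) controls each of
them, and a union bound over `2 + d` events gives the probabilistic estimate.

Consistency follows from two limits: `A(n, τ_n) → 0` under the assumed rate, and `f^τ → f†` as `τ →
0`, the classical behaviour of Tikhonov regularization (`tendsto_of_mem_minimizers_regularized`). -/

namespace DerivReg

/-! ### Hoeffding's inequality in Hilbert space -/

section Concentration

theorem hasSum_cosh_sqrt {q : ℝ} (hq : 0 ≤ q) :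
    HasSum (fun n : ℕ => q ^ n / (2 * n).factorial) (Real.cosh √q) := by
  have h := Real.hasSum_cosh √q
  simpa only [pow_mul, Real.sq_sqrt hq] using h

/-- The power series of `cosh √q` in `q` has nonnegative coefficients, and every power is convex on
`q ≥ 0`. -/
theorem convexOn_cosh_sqrt : ConvexOn ℝ (Ici 0) (fun q => Real.cosh √q) := by
  refine ⟨convex_Ici 0, fun x hx y hy a b ha hb hab => ?_⟩
  have hxy : a • x + b • y ∈ Ici (0 : ℝ) := convex_Ici 0 hx hy ha hb hab
  refine hasSum_le (fun n => ?_) (hasSum_cosh_sqrt hxy)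
    (((hasSum_cosh_sqrt hx).mul_left a).add ((hasSum_cosh_sqrt hy).mul_left b))
  have h := (convexOn_pow (𝕜 := ℝ) n).2 hx hy ha hb hab
  simp only [smul_eq_mul] at h ⊢
  rw [← mul_div_assoc, ← mul_div_assoc, ← add_div]
  gcongr

variable {V : Type*} [NormedAddCommGroup V]

theorem integrable_cosh_norm {Ω' : Type*} [MeasurableSpace Ω'] {P : Measure Ω'}
    [IsFiniteMeasure P] {g : Ω' → V} (hg : StronglyMeasurable g) {C : ℝ} (hC : ∀ ω, ‖g ω‖ ≤ C) :
    Integrable (fun ω => Real.cosh ‖g ω‖) P := by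
  refine .of_bound (Real.continuous_cosh.comp_stronglyMeasurable hg.norm).aestronglyMeasurable
    (Real.cosh C) (.of_forall fun ω => ?_)
  rw [Real.norm_of_nonneg (Real.cosh_pos _).le, Real.cosh_le_cosh,
    abs_of_nonneg (norm_nonneg _)]
  exact (hC ω).trans (le_abs_self C)

theorem stronglyMeasurable_sum_pi {Ω : Type*} [MeasurableSpace Ω] {ξ : Ω → V}
    (hm : StronglyMeasurable ξ) (n : ℕ) :
    StronglyMeasurable fun z : Fin n → Ω => ∑ i, ξ (z i) :=
  Finset.stronglyMeasurable_fun_sum _ fun i _ => hm.comp_measurable (measurable_pi_apply i)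

variable [InnerProductSpace ℝ V]

/-- The bound is affine in `ξ`, so a centred `ξ` leaves only `cosh ‖s‖ * cosh c` after integration.
It comes from convexity of `cosh √q`: `‖s + ξ‖²` lies below a mean of `(‖s‖ + c)²` and `(‖s‖ - c)²`.
-/
theorem cosh_norm_add_le {s ξ : V} {c : ℝ} (hc : 0 < c) (hξ : ‖ξ‖ ≤ c) :
    Real.cosh ‖s + ξ‖ ≤ Real.cosh ‖s‖ * Real.cosh c
      + inner ℝ s ξ / (‖s‖ * c) * (Real.sinh ‖s‖ * Real.sinh c) := by
  set u : ℝ := inner ℝ s ξ / (‖s‖ * c) with hu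
  have habs : |u| ≤ 1 := by
    rw [hu, abs_div, abs_of_nonneg (a := ‖s‖ * c) (by positivity)]
    refine div_le_one_of_le₀ ((abs_real_inner_le_norm s ξ).trans ?_) (by positivity)
    gcongr
  obtain ⟨hu1, hu2⟩ := abs_le.1 habs
  -- For `s = 0` the quotient `u` is `0 / 0 = 0` and both sides vanish.
  have hin : inner ℝ s ξ = ‖s‖ * c * u := by
    rcases eq_or_ne s 0 with rfl | hs
    · simp
    · rw [hu, mul_div_cancel₀]
      have := norm_pos_iff.2 hs
      positivity
  have hsq : ‖s + ξ‖ ^ 2 ≤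
      ((1 + u) / 2) • (‖s‖ + c) ^ 2 + ((1 - u) / 2) • (‖s‖ - c) ^ 2 := by
    rw [norm_add_sq_real, hin, smul_eq_mul, smul_eq_mul]
    have : ‖ξ‖ ^ 2 ≤ c ^ 2 := by gcongr
    linarith
  have h := convexOn_cosh_sqrt.2 (mem_Ici.2 (sq_nonneg (‖s‖ + c))) (mem_Ici.2 (sq_nonneg (‖s‖ - c)))
    (show 0 ≤ (1 + u) / 2 by linarith) (show 0 ≤ (1 - u) / 2 by linarith) (by ring)
  have hmono : Real.cosh ‖s + ξ‖ ≤
      Real.cosh √(((1 + u) / 2) • (‖s‖ + c) ^ 2 + ((1 - u) / 2) • (‖s‖ - c) ^ 2) := by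
    rw [Real.cosh_le_cosh, abs_of_nonneg (norm_nonneg _), abs_of_nonneg (Real.sqrt_nonneg _)]
    exact Real.le_sqrt_of_sq_le hsq
  refine (hmono.trans h).trans_eq ?_
  simp only [Real.sqrt_sq_eq_abs, Real.cosh_abs, smul_eq_mul, Real.cosh_add, Real.cosh_sub]
  ring

variable {Ω : Type*} [MeasurableSpace Ω] {μ : Measure Ω} [IsProbabilityMeasure μ]

theorem integral_cosh_norm_add_le [CompleteSpace V] {ξ : Ω → V} {c : ℝ} (hc : 0 < c)
    (hm : StronglyMeasurable ξ) (hb : ∀ ω, ‖ξ ω‖ ≤ c) (h0 : ∫ ω, ξ ω ∂μ = 0) (s : V) :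
    ∫ ω, Real.cosh ‖s + ξ ω‖ ∂μ ≤ Real.cosh ‖s‖ * Real.cosh c := by
  have hint : Integrable ξ μ := .of_bound hm.aestronglyMeasurable c (.of_forall hb)
  have hi : Integrable (fun ω => inner ℝ s (ξ ω)) μ := hint.const_inner s
  calc ∫ ω, Real.cosh ‖s + ξ ω‖ ∂μ
      ≤ ∫ ω, (Real.cosh ‖s‖ * Real.cosh c
          + inner ℝ s (ξ ω) / (‖s‖ * c) * (Real.sinh ‖s‖ * Real.sinh c)) ∂μ := by
        refine integral_mono_of_nonneg (.of_forall fun ω => (Real.cosh_pos _).le) ?_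
          (.of_forall fun ω => cosh_norm_add_le hc (hb ω))
        exact (integrable_const _).add ((hi.div_const _).mul_const _)
    _ = _ := by
        rw [integral_add (integrable_const _) ((hi.div_const _).mul_const _), integral_const,
          integral_mul_const, integral_div, integral_inner hint, h0]
        simp

theorem integral_cosh_norm_sum_le [CompleteSpace V] {ξ : Ω → V} {c : ℝ} (hc : 0 < c)
    (hm : StronglyMeasurable ξ) (hb : ∀ ω, ‖ξ ω‖ ≤ c) (h0 : ∫ ω, ξ ω ∂μ = 0) (n : ℕ) (s : V) :
    ∫ z, Real.cosh ‖s + ∑ i, ξ (z i)‖ ∂(Measure.pi fun _ : Fin n => μ)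
      ≤ Real.cosh ‖s‖ * Real.cosh c ^ n := by
  -- One coordinate at a time is absorbed into the starting point `s`, which is why `s` is
  -- arbitrary.
  induction n generalizing s with
  | zero => simp
  | succ n ih =>
    have hmp := (measurePreserving_piFinSuccAbove (fun _ : Fin (n + 1) => μ) 0).symm
    rw [← hmp.integral_comp']
    have hcongr : ∀ p : Ω × (Fin n → Ω),
        s + ∑ i, ξ ((MeasurableEquiv.piFinSuccAbove (fun _ : Fin (n + 1) => Ω) 0).symm p i)
          = (s + ξ p.1) + ∑ i, ξ (p.2 i) := by
      intro p
      simp [MeasurableEquiv.piFinSuccAbove_symm_apply, Fin.insertNthEquiv, Fin.sum_univ_succ,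
        add_assoc]
    simp_rw [hcongr]
    have hsum : ∀ z : Fin n → Ω, ‖∑ i, ξ (z i)‖ ≤ n * c := fun z =>
      (norm_sum_le_of_le _ fun i _ => hb (z i)).trans_eq (by simp)
    have hint : Integrable (fun p : Ω × (Fin n → Ω) =>
        Real.cosh ‖(s + ξ p.1) + ∑ i, ξ (p.2 i)‖) (μ.prod (Measure.pi fun _ : Fin n => μ)) := by
      refine integrable_cosh_norm (C := ‖s‖ + c + n * c) ?_ fun p => ?_
      · exact (stronglyMeasurable_const.add (hm.comp_measurable measurable_fst)).add
          ((stronglyMeasurable_sum_pi hm n).comp_measurable measurable_snd)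
      · exact norm_add_le_of_le (norm_add_le_of_le le_rfl (hb _)) (hsum _)
    rw [integral_prod _ hint]
    calc ∫ ω, ∫ z, Real.cosh ‖(s + ξ ω) + ∑ i, ξ (z i)‖ ∂(Measure.pi fun _ : Fin n => μ) ∂μ
        ≤ ∫ ω, Real.cosh ‖s + ξ ω‖ * Real.cosh c ^ n ∂μ := by
          refine integral_mono hint.integral_prod_left (Integrable.mul_const ?_ _) fun ω => ih _
          exact integrable_cosh_norm (stronglyMeasurable_const.add hm) (C := ‖s‖ + c)
            fun ω => norm_add_le_of_le le_rfl (hb _)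
      _ ≤ Real.cosh ‖s‖ * Real.cosh c * Real.cosh c ^ n := by
          rw [integral_mul_const]
          gcongr
          exact integral_cosh_norm_add_le hc hm hb h0 s
      _ = _ := by ring

/-- Hoeffding's inequality for centred, bounded random vectors of a Hilbert space. -/
theorem measure_norm_sum_ge_le [CompleteSpace V] {ξ : Ω → V} {c : ℝ} (hc : 0 < c)
    (hm : StronglyMeasurable ξ) (hb : ∀ ω, ‖ξ ω‖ ≤ c) (h0 : ∫ ω, ξ ω ∂μ = 0) {n : ℕ}
    (hn : 0 < n) {t : ℝ} (ht : 0 < t) :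
    (Measure.pi fun _ : Fin n => μ) {z | t ≤ ‖∑ i, ξ (z i)‖}
      ≤ ENNReal.ofReal (2 * Real.exp (-(t ^ 2 / (2 * n * c ^ 2)))) := by
  have hn' : (0 : ℝ) < n := by exact_mod_cast hn
  -- This value minimizes the Chernoff exponent `n (l c)² / 2 - l t`. The factor `2` of the
  -- conclusion comes from `cosh x ≥ exp x / 2`.
  set l : ℝ := t / (n * c ^ 2) with hl
  have hl0 : 0 < l := by positivity
  have hmain := integral_cosh_norm_sum_le (μ := μ) (ξ := fun ω => l • ξ ω) (c := l * c)
    (by positivity) (hm.const_smul l)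
    (fun ω => by rw [norm_smul, Real.norm_of_nonneg hl0.le]; gcongr; exact hb ω)
    (by rw [integral_smul, h0, smul_zero]) n 0
  simp only [zero_add, norm_zero, Real.cosh_zero, one_mul, ← Finset.smul_sum, norm_smul,
    Real.norm_of_nonneg hl0.le] at hmain
  have hint : Integrable (fun z : Fin n → Ω => Real.cosh (l * ‖∑ i, ξ (z i)‖))
      (Measure.pi fun _ : Fin n => μ) := by
    have := integrable_cosh_norm (P := Measure.pi fun _ : Fin n => μ)
      ((stronglyMeasurable_sum_pi hm n).const_smul l) (C := l * (n * c)) fun z => by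
        simp only [Pi.smul_apply]
        rw [norm_smul, Real.norm_of_nonneg hl0.le]
        gcongr
        exact (norm_sum_le_of_le _ fun i _ => hb (z i)).trans_eq (by simp)
    simpa [norm_smul, abs_of_pos hl0] using this
  have hmarkov := mul_meas_ge_le_integral_of_nonneg
    (.of_forall fun z => (Real.cosh_pos _).le) hint (Real.cosh (l * t))
  have hset : {z : Fin n → Ω | t ≤ ‖∑ i, ξ (z i)‖}
      = {z | Real.cosh (l * t) ≤ Real.cosh (l * ‖∑ i, ξ (z i)‖)} := by
    ext z
    simp only [mem_ofPred_eq, Real.cosh_le_cosh]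
    rw [abs_of_pos (by positivity), abs_of_nonneg (by positivity), mul_le_mul_iff_right₀ hl0]
  rw [hset, ← ENNReal.ofReal_toReal (measure_ne_top _ _)]
  refine ENNReal.ofReal_le_ofReal ?_
  have hcosh : Real.exp (l * t) / 2 ≤ Real.cosh (l * t) := by
    rw [Real.cosh_eq]
    have := Real.exp_pos (-(l * t))
    linarith
  have hup : Real.cosh (l * c) ^ n ≤ Real.exp (n * ((l * c) ^ 2 / 2)) := by
    rw [Real.exp_nat_mul]
    gcongr
    exact Real.cosh_le_exp_half_sq _
  have h2 := hmarkov.trans (hmain.trans hup)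
  have hexp : Real.exp (n * ((l * c) ^ 2 / 2)) =
      Real.exp (l * t) * Real.exp (-(t ^ 2 / (2 * n * c ^ 2))) := by
    rw [← Real.exp_add]
    congr 1
    rw [hl]
    field_simp
    ring
  rw [hexp] at h2
  set m := ((Measure.pi fun _ : Fin n => μ)
    {z | Real.cosh (l * t) ≤ Real.cosh (l * ‖∑ i, ξ (z i)‖)}).toReal with hmdef
  have hm0 : 0 ≤ m := ENNReal.toReal_nonneg
  have h3 : Real.cosh (l * t) * m ≤
      Real.exp (l * t) * Real.exp (-(t ^ 2 / (2 * n * c ^ 2))) := h2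
  have h4 : Real.exp (l * t) / 2 * m ≤
      Real.exp (l * t) * Real.exp (-(t ^ 2 / (2 * n * c ^ 2))) :=
    (mul_le_mul_of_nonneg_right hcosh hm0).trans h3
  have h5 := Real.exp_pos (l * t)
  refine le_of_mul_le_mul_left ?_ h5
  linarith

/-- Deviation of an empirical mean of bounded vectors of a Hilbert space from the mean. -/
theorem measure_norm_mean_sub_integral_gt_le [CompleteSpace V] {ξ : Ω → V} {B : ℝ}
    (hm : StronglyMeasurable ξ) (hb : ∀ ω, ‖ξ ω‖ ≤ B) {n : ℕ} (hn : 0 < n) {l : ℝ} (hl : 0 < l) :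
    (Measure.pi fun _ : Fin n => μ)
        {z | 2 * √2 * B * √l / √n < ‖(n : ℝ)⁻¹ • ∑ i, ξ (z i) - ∫ ω, ξ ω ∂μ‖}
      ≤ ENNReal.ofReal (2 * Real.exp (-l)) := by
  have hn' : (0 : ℝ) < n := by exact_mod_cast hn
  have hΩ : Nonempty Ω := nonempty_of_isProbabilityMeasure μ
  have hB0 : 0 ≤ B := (norm_nonneg _).trans (hb hΩ.some)
  have hint : Integrable ξ μ := .of_bound hm.aestronglyMeasurable B (.of_forall hb)
  have hbm : ‖∫ ω, ξ ω ∂μ‖ ≤ B := by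
    simpa using norm_integral_le_of_norm_le_const (μ := μ) (.of_forall hb)
  have hmean : ∀ z : Fin n → Ω, (n : ℝ)⁻¹ • ∑ i, ξ (z i) - ∫ ω, ξ ω ∂μ
      = (n : ℝ)⁻¹ • ∑ i, (ξ (z i) - ∫ ω, ξ ω ∂μ) := fun z => by
    rw [Finset.sum_sub_distrib, smul_sub, Finset.sum_const, Finset.card_univ, Fintype.card_fin,
      ← Nat.cast_smul_eq_nsmul ℝ, smul_smul, inv_mul_cancel₀ hn'.ne', one_smul]
  have hnorm : ∀ z : Fin n → Ω, ‖(n : ℝ)⁻¹ • ∑ i, ξ (z i) - ∫ ω, ξ ω ∂μ‖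
      = (n : ℝ)⁻¹ * ‖∑ i, (ξ (z i) - ∫ ω, ξ ω ∂μ)‖ := fun z => by
    rw [hmean, norm_smul, Real.norm_of_nonneg (by positivity)]
  have hc : ∀ ω, ‖ξ ω - ∫ ω, ξ ω ∂μ‖ ≤ 2 * B := fun ω =>
    (norm_sub_le_of_le (hb ω) hbm).trans_eq (by ring)
  -- The Hoeffding bound needs a positive radius; for `B = 0` the deviation vanishes identically.
  rcases hB0.eq_or_lt with rfl | hB
  · have : {z : Fin n → Ω | 2 * √2 * 0 * √l / √n
        < ‖(n : ℝ)⁻¹ • ∑ i, ξ (z i) - ∫ ω, ξ ω ∂μ‖} = ∅ := by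
      ext z
      simp only [mem_ofPred_eq, mem_empty_iff_false, iff_false, not_lt, hnorm]
      have : ∀ ω, ξ ω - ∫ ω, ξ ω ∂μ = 0 := fun ω => by simpa using hc ω
      simp [this]
    rw [this]
    simp
  · have hsqrt : √(n : ℝ) * √n = n := Real.mul_self_sqrt hn'.le
    have hsn : 0 < √(n : ℝ) := Real.sqrt_pos.2 hn'
    -- Centring doubles the radius to `2 * B`, and `t` is chosen so that `t² / (2 n (2B)²) = l`.
    refine (measure_mono fun z hz => ?_).trans ((measure_norm_sum_ge_le (μ := μ)
      (ξ := fun ω => ξ ω - ∫ ω, ξ ω ∂μ) (c := 2 * B) (by positivity)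
      (hm.sub stronglyMeasurable_const) hc (by
        rw [integral_sub hint (integrable_const _)]; simp) hn
      (t := √n * (2 * √2 * B * √l)) (by positivity)).trans_eq ?_)
    · rw [mem_ofPred_eq, hnorm, div_lt_iff₀ hsn] at hz
      rw [mem_ofPred_eq]
      calc √n * (2 * √2 * B * √l)
          ≤ √n * ((n : ℝ)⁻¹ * ‖∑ i, (ξ (z i) - ∫ ω, ξ ω ∂μ)‖ * √n) := by gcongr
        _ = (√n * √n) * (n : ℝ)⁻¹ * ‖∑ i, (ξ (z i) - ∫ ω, ξ ω ∂μ)‖ := by ring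
        _ = _ := by rw [hsqrt, mul_inv_cancel₀ hn'.ne', one_mul]
    · congr 4
      rw [mul_pow, mul_pow, mul_pow, mul_pow, Real.sq_sqrt hn'.le, Real.sq_sqrt hl.le,
        Real.sq_sqrt (by norm_num : (0 : ℝ) ≤ 2)]
      field_simp

end Concentration

end DerivReg

namespace DerivReg

/-! ### Strongly convex minimization and Tikhonov limits -/

section Convex

theorem argmin_mem {H : Type*} [Nonempty H] {F : H → ℝ} {S : Set H}
    (h : ∃! f : H, f ∈ minimizers F S) :
    argmin F S ∈ minimizers F S :=
  Classical.epsilon_spec h.exists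

theorem isClosed_minimizers {H : Type*} [TopologicalSpace H] {C : H → ℝ} (hC : Continuous C) :
    IsClosed (minimizers C univ) := by
  have : minimizers C univ = ⋂ g : H, {f | C f ≤ C g} := by
    ext f
    simp [minimizers]
  rw [this]
  exact isClosed_iInter fun g => isClosed_le hC continuous_const

variable {H : Type*} [NormedAddCommGroup H] [InnerProductSpace ℝ H]

theorem norm_sq_convex_combo (f g : H) (t : ℝ) :
    ‖(1 - t) • f + t • g‖ ^ 2
      = (1 - t) * ‖f‖ ^ 2 + t * ‖g‖ ^ 2 - t * (1 - t) * ‖g - f‖ ^ 2 := by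
  rw [norm_add_sq_real, norm_sub_sq_real, norm_smul, norm_smul, inner_smul_left, inner_smul_right,
    mul_pow, mul_pow, Real.norm_eq_abs, Real.norm_eq_abs, sq_abs, sq_abs, real_inner_comm f g]
  simp only [conj_trivial]
  ring

theorem convex_minimizers {C : H → ℝ} (hC : ConvexOn ℝ univ C) : Convex ℝ (minimizers C univ) := by
  intro f hf g hg a b ha hb hab
  refine ⟨trivial, fun h _ => (hC.2 (mem_univ f) (mem_univ g) ha hb hab).trans ?_⟩
  calc a • C f + b • C g ≤ a • C h + b • C h :=
        add_le_add (smul_le_smul_of_nonneg_left (hf.2 h trivial) ha)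
          (smul_le_smul_of_nonneg_left (hg.2 h trivial) hb)
    _ = C h := by rw [← add_smul, hab, one_smul]

variable {C : H → ℝ} {m : ℝ} {S : Set H}

theorem add_norm_sq_combo_le (hC : ConvexOn ℝ univ C) (f g : H) {t : ℝ} (h0 : 0 ≤ t) (h1 : t ≤ 1) :
    C ((1 - t) • f + t • g) + m * ‖(1 - t) • f + t • g‖ ^ 2
      ≤ (1 - t) * (C f + m * ‖f‖ ^ 2) + t * (C g + m * ‖g‖ ^ 2)
        - m * (t * (1 - t) * ‖g - f‖ ^ 2) := by
  have h := hC.2 (mem_univ f) (mem_univ g) (sub_nonneg.2 h1) h0 (by ring)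
  rw [norm_sq_convex_combo]
  simp only [smul_eq_mul] at h
  linarith

/-- Quadratic growth at a minimizer: compare it with the points of the segment towards `g`, divide
by `t` and let `t → 0`. -/
theorem mul_norm_sub_sq_le_of_mem_minimizers (hC : ConvexOn ℝ univ C)
    (hS : Convex ℝ S) {f g : H} (hf : f ∈ minimizers (fun f => C f + m * ‖f‖ ^ 2) S) (hg : g ∈ S) :
    m * ‖g - f‖ ^ 2 ≤ (C g + m * ‖g‖ ^ 2) - (C f + m * ‖f‖ ^ 2) := by
  set δ := (C g + m * ‖g‖ ^ 2) - (C f + m * ‖f‖ ^ 2) with hδ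
  have hδ0 : 0 ≤ δ := sub_nonneg.2 (hf.2 g hg)
  have key : ∀ t : ℝ, 0 < t → t ≤ 1 → (1 - t) * (m * ‖g - f‖ ^ 2) ≤ δ := by
    intro t h0 h1
    have hmem := hS hf.1 hg (sub_nonneg.2 h1) h0.le (by ring)
    have h := (hf.2 _ hmem).trans (add_norm_sq_combo_le hC f g h0.le h1)
    refine le_of_mul_le_mul_left ?_ h0
    rw [hδ]
    linarith
  by_contra! hlt
  set D := m * ‖g - f‖ ^ 2
  have hD : 0 < D := hδ0.trans_lt hlt
  -- If `δ < D`, this `t` makes `(1 - t) D` the midpoint of `δ` and `D`, which exceeds `δ`.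
  have h := key ((D - δ) / (2 * D)) (div_pos (by linarith) (by linarith))
    ((div_le_one (by linarith)).2 (by linarith))
  have : (1 - (D - δ) / (2 * D)) * D = (D + δ) / 2 := by field_simp; ring
  linarith

/-- Minimizing sequences are Cauchy: the midpoint of two near-minimizers would otherwise fall below
the infimum by strong convexity. Uniqueness is quadratic growth. -/
theorem existsUnique_minimizer [CompleteSpace H] (hC : ConvexOn ℝ univ C) (hc : Continuous C)
    (h0 : ∀ f, 0 ≤ C f) (hm : 0 < m) (hS : Convex ℝ S) (hcl : IsClosed S) (hne : S.Nonempty) :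
    ∃! f : H, f ∈ minimizers (fun f => C f + m * ‖f‖ ^ 2) S := by
  set J : H → ℝ := fun f => C f + m * ‖f‖ ^ 2 with hJ
  have hJc : Continuous J := by fun_prop
  have hbdd : BddBelow (J '' S) := by
    refine ⟨0, ?_⟩
    rintro _ ⟨f, -, rfl⟩
    have := h0 f
    positivity
  set I := sInf (J '' S)
  have hI : ∀ f ∈ S, I ≤ J f := fun f hf => csInf_le hbdd (mem_image_of_mem J hf)
  have hex : ∀ n : ℕ, ∃ f ∈ S, J f < I + 1 / ((n : ℝ) + 1) := fun n => by
    obtain ⟨_, ⟨f, hf, rfl⟩, hlt⟩ := exists_lt_of_csInf_lt (hne.image J)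
      (lt_add_of_pos_right I (Nat.one_div_pos_of_nat (n := n)))
    exact ⟨f, hf, hlt⟩
  choose u huS hu using hex
  have hlim : Tendsto (fun n : ℕ => 1 / ((n : ℝ) + 1)) atTop (𝓝 0) :=
    tendsto_one_div_add_atTop_nhds_zero_nat
  have hcauchy : CauchySeq u := by
    refine cauchySeq_of_le_tendsto_0 (fun N : ℕ => √(4 / m * (1 / ((N : ℝ) + 1)))) ?_ ?_
    · intro p q N hp hq
      rw [dist_comm, dist_eq_norm]
      refine Real.le_sqrt_of_sq_le ?_
      have hmid := (hI _ (hS (huS p) (huS q) (a := 1 - 1 / 2) (b := 1 / 2) (by norm_num)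
        (by norm_num) (by norm_num))).trans
          (add_norm_sq_combo_le hC (u p) (u q) (by norm_num) (by norm_num))
      have hp' : 1 / ((p : ℝ) + 1) ≤ 1 / ((N : ℝ) + 1) := Nat.one_div_le_one_div hp
      have hq' : 1 / ((q : ℝ) + 1) ≤ 1 / ((N : ℝ) + 1) := Nat.one_div_le_one_div hq
      have h1 := hu p
      have h2 := hu q
      simp only [hJ] at h1 h2
      rw [div_mul_eq_mul_div, le_div_iff₀ hm]
      linarith
    · have := ((hlim.const_mul (4 / m)).sqrt)
      simpa using this
  obtain ⟨f, hf⟩ := cauchySeq_tendsto_of_complete hcauchy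
  have hfS : f ∈ S := hcl.mem_of_tendsto hf (.of_forall huS)
  have hJf : J f ≤ I := by
    refine le_of_tendsto_of_tendsto ((hJc.tendsto f).comp hf) ?_ (.of_forall fun n => (hu n).le)
    simpa using hlim.const_add I
  have hfm : f ∈ minimizers J S := ⟨hfS, fun g hg => hJf.trans (hI g hg)⟩
  refine ⟨f, hfm, fun g hg => ?_⟩
  have h1 := mul_norm_sub_sq_le_of_mem_minimizers hC hS hfm hg.1
  have h2 := hg.2 f hfS
  have h3 : m * ‖g - f‖ ^ 2 ≤ 0 := h1.trans (sub_nonpos.2 h2)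
  have h4 : ‖g - f‖ ^ 2 ≤ 0 := nonpos_of_mul_nonpos_right h3 hm
  exact sub_eq_zero.1 (norm_eq_zero.1 (pow_eq_zero_iff two_ne_zero |>.1
    (le_antisymm h4 (sq_nonneg _))))

/-- Convergence of Tikhonov regularization as the parameter tends to zero. -/
theorem tendsto_of_mem_minimizers_regularized [CompleteSpace H] {E : H → ℝ}
    (hE : ConvexOn ℝ univ E) (hEc : Continuous E) (hC : ConvexOn ℝ univ C) (hc : Continuous C)
    (h0 : ∀ f, 0 ≤ C f) (hm : 0 < m) {f₀ : H}
    (hf₀ : f₀ ∈ minimizers (fun f => C f + m * ‖f‖ ^ 2) (minimizers E univ)) {f : ℝ → H}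
    (hf : ∀ τ, 0 < τ → f τ ∈ minimizers (fun f => E f + τ * (C f + m * ‖f‖ ^ 2)) univ) :
    Tendsto f (𝓝[>] 0) (𝓝 f₀) := by
  set P : H → ℝ := fun f => C f + m * ‖f‖ ^ 2 with hP
  have hPc : Continuous P := by fun_prop
  have hP0 : ∀ g, 0 ≤ P g := fun g => by
    have := h0 g
    positivity
  have hle : ∀ τ, 0 < τ → P (f τ) ≤ P f₀ := fun τ hτ => by
    have h1 := (hf τ hτ).2 f₀ trivial
    have h2 := hf₀.1.2 (f τ) trivial
    refine le_of_mul_le_mul_left ?_ hτ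
    linarith
  -- Add quadratic growth at `f τ` to the optimality of `f σ`: the terms in `E` cancel. Hence `P (f
  -- τ)` decreases in `τ` and its increments control distances.
  have hstep : ∀ σ τ, 0 < σ → σ < τ → m * ‖f σ - f τ‖ ^ 2 ≤ P (f σ) - P (f τ) := by
    intro σ τ hσ hστ
    have hτ := hσ.trans hστ
    have hconv : ConvexOn ℝ univ fun f => E f + τ * C f := hE.add (hC.smul hτ.le)
    have hfτ : f τ ∈ minimizers (fun f => (E f + τ * C f) + (τ * m) * ‖f‖ ^ 2) univ := by
      convert hf τ hτ using 2
      ext g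
      ring
    have h1 := mul_norm_sub_sq_le_of_mem_minimizers hconv convex_univ hfτ
      (mem_univ (f σ))
    have h2 := (hf σ hσ).2 (f τ) trivial
    have h3 : τ * (m * ‖f σ - f τ‖ ^ 2) ≤ (τ - σ) * (P (f σ) - P (f τ)) := by
      simp only [hP] at h2 ⊢
      linarith
    have h4 : 0 ≤ P (f σ) - P (f τ) := by
      have : 0 ≤ τ * (m * ‖f σ - f τ‖ ^ 2) := by positivity
      exact nonneg_of_mul_nonneg_right (this.trans h3) (sub_pos.2 hστ)
    refine le_of_mul_le_mul_left (h3.trans ?_) hτ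
    gcongr
    linarith
  set Q : Set ℝ := (fun τ => P (f τ)) '' Ioi 0
  have hQne : Q.Nonempty := ⟨_, mem_image_of_mem _ (mem_Ioi.2 one_pos)⟩
  have hQb : BddAbove Q := ⟨P f₀, by rintro _ ⟨τ, hτ, rfl⟩; exact hle τ hτ⟩
  -- `P ∘ f` is monotone and bounded by `P f₀`, so its increments near `0` are small. This gives
  -- norm convergence directly, without weak compactness.
  have hcauchy : Cauchy (map f (𝓝[>] 0)) := by
    rw [Metric.cauchy_iff]
    refine ⟨inferInstance, fun ε hε => ?_⟩
    obtain ⟨_, ⟨τ, hτ, rfl⟩, hlt⟩ := exists_lt_of_lt_csSup hQne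
      (sub_lt_self (sSup Q) (show 0 < m * (ε / 2) ^ 2 by positivity))
    have hτ' : 0 < τ := hτ
    refine ⟨f '' Ioo 0 τ, image_mem_map (Ioo_mem_nhdsGT hτ'), ?_⟩
    have hnear : ∀ σ ∈ Ioo 0 τ, dist (f σ) (f τ) < ε / 2 := by
      intro σ hσ
      have h1 := hstep σ τ hσ.1 hσ.2
      have h2 : P (f σ) ≤ sSup Q := le_csSup hQb (mem_image_of_mem _ hσ.1)
      have h3 : ‖f σ - f τ‖ ^ 2 < (ε / 2) ^ 2 := by
        refine lt_of_mul_lt_mul_left ?_ hm.le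
        simp only at hlt
        linarith
      rw [dist_eq_norm]
      exact lt_of_pow_lt_pow_left₀ 2 (by positivity) h3
    rintro _ ⟨σ, hσ, rfl⟩ _ ⟨σ', hσ', rfl⟩
    calc dist (f σ) (f σ') ≤ dist (f σ) (f τ) + dist (f σ') (f τ) := dist_triangle_right _ _ _
      _ < ε := by linarith [hnear σ hσ, hnear σ' hσ']
  obtain ⟨g, hg⟩ := CompleteSpace.complete hcauchy
  have hg : Tendsto f (𝓝[>] 0) (𝓝 g) := hg
  have hpos : ∀ᶠ τ : ℝ in 𝓝[>] 0, 0 < τ := self_mem_nhdsWithin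
  have hgE : E g ≤ E f₀ := by
    refine le_of_tendsto_of_tendsto ((hEc.tendsto g).comp hg)
      (g := fun τ : ℝ => E f₀ + τ * P f₀) ?_ ?_
    · have : Tendsto (fun τ : ℝ => E f₀ + τ * P f₀) (𝓝 0) (𝓝 (E f₀ + 0 * P f₀)) := by
        apply Continuous.tendsto (f := fun τ : ℝ => E f₀ + τ * P f₀)
        fun_prop
      rw [zero_mul, add_zero] at this
      exact this.mono_left nhdsWithin_le_nhds
    · filter_upwards [hpos] with τ hτ
      have h1 := (hf τ hτ).2 f₀ trivial
      have h2 := mul_nonneg hτ.le (hP0 (f τ))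
      simp only [Function.comp, hP] at h1 h2 ⊢
      linarith
  have hgP : P g ≤ P f₀ :=
    le_of_tendsto ((hPc.tendsto g).comp hg) (by filter_upwards [hpos] with τ hτ using hle τ hτ)
  have hgm : g ∈ minimizers P (minimizers E univ) :=
    ⟨⟨trivial, fun h _ => hgE.trans (hf₀.1.2 h trivial)⟩, fun h hh => hgP.trans (hf₀.2 h hh)⟩
  have hu := (existsUnique_minimizer hC hc h0 hm (convex_minimizers hE)
    (isClosed_minimizers hEc) ⟨g, hgm.1⟩).unique hgm hf₀
  exact hu ▸ hg

end Convex

end DerivReg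

namespace DerivReg

/-! ### Representers of partial derivatives -/

section KernelDerivative

/-- The two increments tend to zero independently, so `fderiv ℝ F` must be strictly differentiable
at `p`; the mean value inequality in the first increment then transfers its linearization to `F`. -/
theorem tendsto_mixed_difference {W : Type*} [NormedAddCommGroup W] [NormedSpace ℝ W]
    {F : W → ℝ} {p : W} (hF : ContDiffAt ℝ 2 F p) (u v : W) :
    Tendsto (fun h : ℝ × ℝ => h.1⁻¹ * h.2⁻¹ *
        (F (p + h.1 • u + h.2 • v) - F (p + h.1 • u) - (F (p + h.2 • v) - F p)))
      (𝓝[≠] 0 ×ˢ 𝓝[≠] 0) (𝓝 (fderiv ℝ (fderiv ℝ F) p v u)) := by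
  have hstrict : HasStrictFDerivAt (fderiv ℝ F) (fderiv ℝ (fderiv ℝ F) p) p :=
    (hF.fderiv_right (m := 1) (by norm_num)).hasStrictFDerivAt (by norm_num)
  set L := fderiv ℝ (fderiv ℝ F) p
  have hdiff : ∀ᶠ q in 𝓝 p, DifferentiableAt ℝ F q :=
    (hF.eventually (by simp)).mono fun q hq => hq.differentiableAt (by norm_num)
  rw [Metric.tendsto_nhds]
  intro ε hε
  -- The `+ 1` covers the case where `u` or `v` is zero.
  set ε' := ε / (2 * (‖v‖ * ‖u‖ + 1)) with hε'
  have hε'0 : 0 < ε' := by positivity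
  have hlip : ∀ᶠ q : W × W in 𝓝 (p, p),
      ‖fderiv ℝ F q.1 - fderiv ℝ F q.2 - L (q.1 - q.2)‖ ≤ ε' * ‖q.1 - q.2‖ :=
    hstrict.isLittleO.def hε'0
  have hall : ∀ᶠ q : W × W in 𝓝 (p, p),
      ‖fderiv ℝ F q.1 - fderiv ℝ F q.2 - L (q.1 - q.2)‖ ≤ ε' * ‖q.1 - q.2‖ ∧
        DifferentiableAt ℝ F q.1 ∧ DifferentiableAt ℝ F q.2 := by
    refine hlip.and (Eventually.and ?_ ?_)
    · exact (continuous_fst.tendsto (p, p)).eventually hdiff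
    · exact (continuous_snd.tendsto (p, p)).eventually hdiff
  have hcont : Tendsto (fun h : ℝ × ℝ => (p + h.1 • u + h.2 • v, p + h.1 • u)) (𝓝 (0, 0))
      (𝓝 (p, p)) := by
    have : Continuous fun h : ℝ × ℝ => (p + h.1 • u + h.2 • v, p + h.1 • u) := by fun_prop
    simpa using this.tendsto (0, 0)
  obtain ⟨r, hr, hball⟩ := Metric.eventually_nhds_iff_ball.1 (hcont.eventually hall)
  have hne : ∀ᶠ h : ℝ in 𝓝[≠] 0, h ≠ 0 ∧ |h| < r := by
    refine eventually_mem_nhdsWithin.and ?_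
    filter_upwards [mem_nhdsWithin_of_mem_nhds (Metric.ball_mem_nhds (0 : ℝ) hr)] with h hh
    simpa using hh
  filter_upwards [hne.prod_mk hne] with ⟨h, k⟩ ⟨⟨hh0, hhr⟩, hk0, hkr⟩
  simp only at hh0 hhr hk0 hkr ⊢
  have hmem : ∀ s ∈ Metric.closedBall (0 : ℝ) |h|, (s, k) ∈ Metric.ball ((0 : ℝ), (0 : ℝ)) r := by
    intro s hs
    rw [mem_closedBall_zero_iff, Real.norm_eq_abs] at hs
    rw [Metric.mem_ball, Prod.dist_eq]
    simp [hs.trans_lt hhr, hkr]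
  have hder : ∀ s ∈ Metric.closedBall (0 : ℝ) |h|,
      HasDerivWithinAt (fun s : ℝ => F (p + s • u + k • v) - F (p + s • u) - s * (k * L v u))
        ((fderiv ℝ F (p + s • u + k • v) - fderiv ℝ F (p + s • u) - L (k • v)) u)
        (Metric.closedBall (0 : ℝ) |h|) s := by
    intro s hs
    obtain ⟨-, h1, h2⟩ := hball _ (hmem s hs)
    have hline : HasDerivAt (fun s : ℝ => p + s • u) u s := by
      simpa using ((hasDerivAt_id s).smul_const u).const_add p
    have d1 := h1.hasFDerivAt.comp_hasDerivAt s (hline.add_const (k • v))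
    have d2 := h2.hasFDerivAt.comp_hasDerivAt s hline
    have d3 := (hasDerivAt_id s).mul_const (k * L v u)
    refine HasDerivAt.hasDerivWithinAt (((d1.sub d2).sub d3).congr_deriv ?_)
    simp
  have hbd : ∀ s ∈ Metric.closedBall (0 : ℝ) |h|,
      ‖(fderiv ℝ F (p + s • u + k • v) - fderiv ℝ F (p + s • u) - L (k • v)) u‖
        ≤ ε' * (|k| * ‖v‖) * ‖u‖ := by
    intro s hs
    obtain ⟨h1, -, -⟩ := hball _ (hmem s hs)
    simp only [add_sub_cancel_left] at h1
    refine (ContinuousLinearMap.le_opNorm _ _).trans ?_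
    gcongr
    simpa [norm_smul] using h1
  have hmvt := (convex_closedBall (0 : ℝ) |h|).norm_image_sub_le_of_norm_hasDerivWithin_le hder hbd
    (show (0 : ℝ) ∈ _ by simp) (show h ∈ _ by simp)
  simp only [zero_smul, add_zero, zero_mul, sub_zero, Real.norm_eq_abs] at hmvt
  set A := F (p + h • u + k • v) - F (p + h • u) - (F (p + k • v) - F p) with hA
  have hrew : h⁻¹ * k⁻¹ * A - L v u = h⁻¹ * k⁻¹ * (A - h * (k * L v u)) := by
    field_simp
  have hA' : |A - h * (k * L v u)| ≤ ε' * (|k| * ‖v‖) * ‖u‖ * |h| := by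
    convert hmvt using 2
    rw [hA]
    ring
  rw [Real.dist_eq, hrew, abs_mul, abs_mul, abs_inv, abs_inv]
  have hh : 0 < |h| := abs_pos.2 hh0
  have hk : 0 < |k| := abs_pos.2 hk0
  calc |h|⁻¹ * |k|⁻¹ * |A - h * (k * L v u)|
      ≤ |h|⁻¹ * |k|⁻¹ * (ε' * (|k| * ‖v‖) * ‖u‖ * |h|) := by gcongr
    _ = ε' * (‖v‖ * ‖u‖) := by field_simp
    _ < ε := by
      rw [hε', div_mul_eq_mul_div, div_lt_iff₀ (by positivity)]
      have : 0 ≤ ‖v‖ * ‖u‖ := by positivity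
      nlinarith

/-- Expanding `‖q - q'‖²` gives the limit `c - 2c + c = 0`, so `q` is Cauchy along `l`. -/
theorem exists_tendsto_of_tendsto_inner {H ι : Type*} [NormedAddCommGroup H]
    [InnerProductSpace ℝ H] [CompleteSpace H] {l : Filter ι} [l.NeBot] {q : ι → H} {c : ℝ}
    (h : Tendsto (fun p : ι × ι => inner ℝ (q p.1) (q p.2)) (l ×ˢ l) (𝓝 c)) :
    ∃ D, Tendsto q l (𝓝 D) := by
  have hfst : Tendsto (fun p : ι × ι => (p.1, p.1)) (l ×ˢ l) (l ×ˢ l) :=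
    tendsto_fst.prodMk tendsto_fst
  have hsnd : Tendsto (fun p : ι × ι => (p.2, p.2)) (l ×ˢ l) (l ×ˢ l) :=
    tendsto_snd.prodMk tendsto_snd
  have hsq : Tendsto (fun p : ι × ι => ‖q p.1 - q p.2‖ ^ 2) (l ×ˢ l) (𝓝 0) := by
    have := ((h.comp hfst).sub (h.const_mul 2)).add (h.comp hsnd)
    rw [show c - 2 * c + c = 0 by ring] at this
    refine this.congr fun p => ?_
    simp [norm_sub_sq_real]
  have hc : Cauchy (map q l) := by
    rw [cauchy_map_iff]
    refine ⟨inferInstance, ?_⟩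
    rw [Metric.uniformity_eq_comap_nhds_zero, tendsto_comap_iff]
    have := hsq.sqrt
    rw [Real.sqrt_zero] at this
    refine this.congr fun p => ?_
    simp [dist_eq_norm]
  exact CompleteSpace.complete hc

section Feature

variable {W H : Type*} [NormedAddCommGroup W] [NormedSpace ℝ W] [NormedAddCommGroup H]
  [InnerProductSpace ℝ H] {F : W × W → ℝ} {φ : W → H} {U : Set W}

theorem tendsto_inner_slope (hU : IsOpen U) (hF : ContDiffOn ℝ 2 F (U ×ˢ U))
    (hφ : ∀ x ∈ U, ∀ y ∈ U, inner ℝ (φ x) (φ y) = F (x, y)) {x y : W} (hx : x ∈ U) (hy : y ∈ U)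
    (u v : W) :
    Tendsto (fun h : ℝ × ℝ => inner ℝ (h.1⁻¹ • (φ (x + h.1 • u) - φ x))
        (h.2⁻¹ • (φ (y + h.2 • v) - φ y)))
      (𝓝[≠] 0 ×ˢ 𝓝[≠] 0) (𝓝 (iteratedFDeriv ℝ 2 F (x, y) ![(0, v), (u, 0)])) := by
  have hF' : ContDiffAt ℝ 2 F (x, y) :=
    hF.contDiffAt ((hU.prod hU).mem_nhds ⟨hx, hy⟩)
  have hev : ∀ {x : W}, x ∈ U → ∀ u : W, ∀ᶠ h : ℝ in 𝓝[≠] 0, x + h • u ∈ U := by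
    intro x hx u
    have hc : Continuous fun h : ℝ => x + h • u := by fun_prop
    exact mem_nhdsWithin_of_mem_nhds
      ((hU.preimage hc).mem_nhds (by simpa using hx))
  have h2 : iteratedFDeriv ℝ 2 F (x, y) ![(0, v), (u, 0)]
      = fderiv ℝ (fderiv ℝ F) (x, y) (0, v) (u, 0) := by
    simp [iteratedFDeriv_two_apply]
  rw [h2]
  refine (tendsto_mixed_difference hF' (u, 0) (0, v)).congr' ?_
  filter_upwards [(hev hx u).prod_mk (hev hy v)] with ⟨h, k⟩ ⟨hh, hk⟩
  simp only [Prod.smul_mk, Prod.mk_add_mk, smul_zero, add_zero, inner_smul_left, inner_smul_right,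
    inner_sub_left, inner_sub_right, conj_trivial] at hh hk ⊢
  rw [hφ _ hh _ hk, hφ _ hh _ hy, hφ _ hx _ hk, hφ _ hx _ hy]
  ring

/-- Inner products of difference quotients of `φ` are mixed difference quotients of the kernel,
which converge because `F` is `C^2`. -/
theorem exists_hasLineDerivAt_feature [CompleteSpace H] (hU : IsOpen U)
    (hF : ContDiffOn ℝ 2 F (U ×ˢ U))
    (hφ : ∀ x ∈ U, ∀ y ∈ U, inner ℝ (φ x) (φ y) = F (x, y)) {x : W} (hx : x ∈ U) (u : W) :
    ∃ D : H, HasLineDerivAt ℝ φ D x u := by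
  obtain ⟨D, hD⟩ := exists_tendsto_of_tendsto_inner
    (q := fun h : ℝ => h⁻¹ • (φ (x + h • u) - φ x)) (tendsto_inner_slope hU hF hφ hx hx u u)
  refine ⟨D, ?_⟩
  rw [HasLineDerivAt, hasDerivAt_iff_tendsto_slope]
  refine hD.congr fun t => ?_
  simp [slope_def_module]

theorem inner_eq_iteratedFDeriv (hU : IsOpen U) (hF : ContDiffOn ℝ 2 F (U ×ˢ U))
    (hφ : ∀ x ∈ U, ∀ y ∈ U, inner ℝ (φ x) (φ y) = F (x, y)) {x y : W} (hx : x ∈ U) (hy : y ∈ U)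
    {u v : W} {D D' : H} (hD : HasLineDerivAt ℝ φ D x u) (hD' : HasLineDerivAt ℝ φ D' y v) :
    inner ℝ D D' = iteratedFDeriv ℝ 2 F (x, y) ![(0, v), (u, 0)] := by
  rw [HasLineDerivAt, hasDerivAt_iff_tendsto_slope] at hD hD'
  refine tendsto_nhds_unique ?_ (tendsto_inner_slope hU hF hφ hx hy u v)
  refine ((hD.comp tendsto_fst).inner (hD'.comp tendsto_snd)).congr fun h => ?_
  simp [slope_def_module]

end Feature

variable {d : ℕ} {X : Set (EuclideanSpace ℝ (Fin d))}
  {H : Type*} [NormedAddCommGroup H] [InnerProductSpace ℝ H] [CompleteSpace H] [RKHS ℝ H X ℝ]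

theorem inner_kfun (x : X) (f : H) : inner ℝ (kfun H x) f = f x := by
  simp [kfun]

theorem inner_kfun_kfun (x y : X) : inner ℝ (kfun H x) (kfun H y) = ker H x y := by
  rw [real_inner_comm, inner_kfun, ker]

variable (H) in
theorem continuous_kfun (hk : KernelC2 H) : Continuous (kfun H) := by
  have hker : Continuous fun p : X × X => ker H p.1 p.2 := by
    have h1 := hk.1.comp_continuous (f := fun p : X × X => ((p.1 : EuclideanSpace ℝ (Fin d)),
      (p.2 : EuclideanSpace ℝ (Fin d)))) (by fun_prop) (fun p => ⟨p.1.2, p.2.2⟩)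
    refine h1.congr fun p => ?_
    exact (Subtype.val_injective.prodMap Subtype.val_injective).extend_apply _ _ p
  rw [continuous_iff_continuousAt]
  intro x
  rw [ContinuousAt, tendsto_iff_norm_sub_tendsto_zero]
  have hsq : Tendsto (fun y : X => ker H y y - 2 * ker H y x + ker H x x) (𝓝 x) (𝓝 0) := by
    have hc : Continuous fun y : X => ker H y y - 2 * ker H y x + ker H x x :=
      ((hker.comp (continuous_id.prodMk continuous_id)).sub
        ((hker.comp (continuous_id.prodMk continuous_const)).const_mul 2)).add_const _
    have := hc.tendsto x
    rwa [show ker H x x - 2 * ker H x x + ker H x x = 0 by ring] at this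
  have := hsq.sqrt
  rw [Real.sqrt_zero] at this
  refine this.congr fun y => ?_
  rw [← inner_kfun_kfun, ← inner_kfun_kfun, ← inner_kfun_kfun, real_inner_self_eq_norm_sq,
    real_inner_self_eq_norm_sq, ← norm_sub_sq_real, Real.sqrt_sq (norm_nonneg _)]

variable (H) in
/-- Partial derivatives of the functions of `H` are represented by a continuous map into `H`. -/
theorem exists_pderiv_representer (hX : closure X = closure (interior X)) (hk : KernelC2 H)
    (a : Fin d) :
    ∃ D : X → H, Continuous D ∧ ∀ (x : X) (f : H), pderiv a f x = inner ℝ (D x) f := by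
  obtain ⟨-, hF, hG⟩ := hk
  obtain ⟨G, hGc, hGe⟩ := hG 2 le_rfl
  set F : EuclideanSpace ℝ (Fin d) × EuclideanSpace ℝ (Fin d) → ℝ :=
    Function.extend (Prod.map Subtype.val Subtype.val) (fun p : X × X => ker H p.1 p.2) 0
  set e : EuclideanSpace ℝ (Fin d) := EuclideanSpace.single a 1
  set U := interior X with hU
  rw [interior_prod_eq] at hF hGe
  have hUo : IsOpen U := isOpen_interior
  have hUX : U ⊆ X := interior_subset
  set φ : EuclideanSpace ℝ (Fin d) → H := Function.extend Subtype.val (kfun H) 0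
  have hφX : ∀ x (hx : x ∈ X), φ x = kfun H ⟨x, hx⟩ := fun x hx =>
    Subtype.val_injective.extend_apply (kfun H) 0 ⟨x, hx⟩
  have hφ : ∀ x ∈ U, ∀ y ∈ U, inner ℝ (φ x) (φ y) = F (x, y) := by
    intro x hx y hy
    rw [hφX x (hUX hx), hφX y (hUX hy), inner_kfun_kfun]
    exact ((Subtype.val_injective.prodMap Subtype.val_injective).extend_apply
      (fun p : X × X => ker H p.1 p.2) 0 (⟨x, hUX hx⟩, ⟨y, hUX hy⟩)).symm
  have hex : ∀ x, ∃ D : H, x ∈ U → HasLineDerivAt ℝ φ D x e := by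
    intro x
    by_cases hx : x ∈ U
    · obtain ⟨D, hD⟩ := exists_hasLineDerivAt_feature hUo hF hφ hx e
      exact ⟨D, fun _ => hD⟩
    · exact ⟨0, fun h => absurd h hx⟩
  choose D hD using hex
  have hXcl : X ⊆ closure U := subset_closure.trans hX.subset
  -- The same Cauchy criterion works up to the boundary: `⟪D x, D y⟫` is a mixed second derivative
  -- of the kernel, which extends continuously to `X × X`.
  have hlim : ∀ x ∈ X, ∃ g, Tendsto D (𝓝[U] x) (𝓝 g) := by
    intro x hx
    have : (𝓝[U] x).NeBot := mem_closure_iff_nhdsWithin_neBot.1 (hXcl hx)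
    refine exists_tendsto_of_tendsto_inner (c := G (x, x) ![(0, e), (e, 0)]) ?_
    have h1 : Tendsto G (𝓝[U ×ˢ U] (x, x)) (𝓝 (G (x, x))) :=
      (hGc (x, x) ⟨hx, hx⟩).mono_left (nhdsWithin_mono _ (prod_mono hUX hUX))
    have h2 : Tendsto (fun p => G p ![(0, e), (e, 0)]) (𝓝[U ×ˢ U] (x, x))
        (𝓝 (G (x, x) ![(0, e), (e, 0)])) :=
      ((continuous_eval_const (![(0, e), (e, 0)] : Fin 2 → _)).tendsto _).comp h1
    rw [← nhdsWithin_prod_eq]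
    refine h2.congr' ?_
    filter_upwards [self_mem_nhdsWithin] with p hp
    rw [← hGe hp]
    exact (inner_eq_iteratedFDeriv hUo hF hφ hp.1 hp.2 (hD _ hp.1) (hD _ hp.2)).symm
  refine ⟨fun x => extendFrom U D x, ?_, fun x f => ?_⟩
  · exact (continuousOn_extendFrom hXcl hlim).comp_continuous continuous_subtype_val
      fun x => x.2
  · refine extendFrom_eq (hXcl x.2) ?_
    have h1 : Tendsto D (𝓝[U] (x : EuclideanSpace ℝ (Fin d))) (𝓝 (extendFrom U D x)) :=
      tendsto_extendFrom (hlim x x.2)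
    refine (h1.inner tendsto_const_nhds).congr' ?_
    filter_upwards [self_mem_nhdsWithin] with y hy
    have h2 : HasLineDerivAt ℝ (fun z => inner ℝ (φ z) f) (inner ℝ (D y) f) y e := by
      have := HasDerivAt.inner ℝ (hD y hy) (hasDerivAt_const 0 f)
      simpa [HasLineDerivAt] using this
    have h3 : (Function.extend Subtype.val f 0 : EuclideanSpace ℝ (Fin d) → ℝ) =ᶠ[𝓝 y]
        fun z => inner ℝ (φ z) f := by
      filter_upwards [hUo.mem_nhds hy] with z hz
      rw [hφX z (hUX hz), inner_kfun]
      exact Subtype.val_injective.extend_apply f 0 ⟨z, hUX hz⟩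
    exact ((h2.congr_of_eventuallyEq h3).lineDeriv).symm

/-- By symmetry of the kernel, the representer `D x` is itself the function `(∂_a k)_x`, so the
assumed bound applies to it. -/
theorem norm_pderiv_representer_le {a : Fin d} {D : X → H} {κ' : ℝ}
    (hD : ∀ (x : X) (f : H), pderiv a f x = inner ℝ (D x) f)
    (hb : ∀ (x : X) (g : H), IsKernelDeriv a x g → ‖g‖ ≤ κ') (x : X) : ‖D x‖ ≤ κ' := by
  refine hb x _ fun t => ?_
  have h1 : (fun s => ker H s t) = (kfun H t : X → ℝ) := by
    ext s
    rw [← inner_kfun_kfun, inner_kfun]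
  rw [h1, hD, real_inner_comm, inner_kfun]

end KernelDerivative

end DerivReg

noncomputable section

namespace DerivReg

/-! ### Quadratic functionals as linear functionals of second moments -/

section TensorSquare

open scoped TensorProduct

variable {H : Type*} [NormedAddCommGroup H] [InnerProductSpace ℝ H]

/-- The tensor square `f ⊗ f` in the Hilbert space tensor square of `H`. -/
def tensorSq (f : H) : UniformSpace.Completion (H ⊗[ℝ] H) := ((f ⊗ₜ[ℝ] f : H ⊗[ℝ] H) :)

theorem inner_tensorSq (f g : H) : inner ℝ (tensorSq f) (tensorSq g) = inner ℝ f g ^ 2 := by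
  rw [tensorSq, tensorSq, UniformSpace.Completion.inner_coe, TensorProduct.inner_tmul, sq]

theorem norm_tensorSq (f : H) : ‖tensorSq f‖ = ‖f‖ ^ 2 := by
  rw [tensorSq, UniformSpace.Completion.norm_coe, TensorProduct.norm_tmul, sq]

theorem tensorSq_zero : tensorSq (0 : H) = 0 :=
  norm_eq_zero.1 (by rw [norm_tensorSq, norm_zero, zero_pow two_ne_zero])

theorem norm_tensorSq_le {f : H} {B : ℝ} (h : ‖f‖ ≤ B) : ‖tensorSq f‖ ≤ B ^ 2 := by
  rw [norm_tensorSq]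
  gcongr

theorem continuous_tensorSq : Continuous (tensorSq : H → _) :=
  (UniformSpace.Completion.continuous_coe _).comp
    (TensorProduct.continuous_tmul.comp (continuous_id.prodMk continuous_id))

/-- This is `√a - √b ≤ √(a - b)` with Cauchy–Schwarz. The square root costs half of the rate and
produces the `n^{1/4}` in the bound. -/
theorem sqrt_inner_tensorSq_sub_le (f : H) {S S' : UniformSpace.Completion (H ⊗[ℝ] H)} {R : ℝ}
    (hf : ‖f‖ ≤ R) :
    √(inner ℝ (tensorSq f) S) - √(inner ℝ (tensorSq f) S') ≤ R * √‖S - S'‖ := by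
  have h1 : inner ℝ (tensorSq f) S ≤ inner ℝ (tensorSq f) S' + R ^ 2 * ‖S - S'‖ := by
    have h2 : inner ℝ (tensorSq f) (S - S') ≤ R ^ 2 * ‖S - S'‖ :=
      (real_inner_le_norm _ _).trans (by gcongr; exact norm_tensorSq_le hf)
    rw [inner_sub_right] at h2
    linarith
  have hR : 0 ≤ R := (norm_nonneg _).trans hf
  set b := inner ℝ (tensorSq f) S'
  -- For an arbitrary `S'` the number `b` may be negative, where `√b = 0`.
  have h3 : b ≤ √b ^ 2 := by
    rcases le_total 0 b with hb | hb
    · rw [Real.sq_sqrt hb]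
    · exact hb.trans (sq_nonneg _)
  have h4 := Real.sq_sqrt (norm_nonneg (S - S'))
  rw [sub_le_iff_le_add, Real.sqrt_le_iff]
  refine ⟨by positivity, h1.trans ?_⟩
  have h5 : 0 ≤ R * √‖S - S'‖ * √b := by positivity
  nlinarith

variable {Z : Type*} [MeasurableSpace Z] {φ : Z → H} {B : ℝ} (μ : Measure Z) [IsFiniteMeasure μ]

theorem integrable_tensorSq (hφ : StronglyMeasurable φ) (hB : ∀ p, ‖φ p‖ ≤ B) :
    Integrable (fun p => tensorSq (φ p)) μ :=
  .of_bound (continuous_tensorSq.comp_stronglyMeasurable hφ).aestronglyMeasurable (B ^ 2)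
    (.of_forall fun p => norm_tensorSq_le (hB p))

theorem integral_inner_sq (hφ : StronglyMeasurable φ) (hB : ∀ p, ‖φ p‖ ≤ B) (f : H) :
    ∫ p, inner ℝ (φ p) f ^ 2 ∂μ = inner ℝ (tensorSq f) (∫ p, tensorSq (φ p) ∂μ) := by
  rw [← integral_inner (integrable_tensorSq μ hφ hB)]
  simp_rw [inner_tensorSq, real_inner_comm]

theorem memLp_inner (hφ : StronglyMeasurable φ) (hB : ∀ p, ‖φ p‖ ≤ B) (f : H) :
    MemLp (fun p => inner ℝ (φ p) f) 2 μ :=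
  .of_bound (hφ.inner stronglyMeasurable_const).aestronglyMeasurable (B * ‖f‖)
    (.of_forall fun p => (norm_inner_le_norm _ _).trans (by gcongr; exact hB p))

/-- The function is the `L²` norm composed with the linear map `f ↦ ⟪φ ·, f⟫`. -/
theorem convexOn_sqrt_integral_inner_sq (hφ : StronglyMeasurable φ) (hB : ∀ p, ‖φ p‖ ≤ B) :
    ConvexOn ℝ univ fun f : H => √(∫ p, inner ℝ (φ p) f ^ 2 ∂μ) := by
  let Λ : H →ₗ[ℝ] Lp ℝ 2 μ :=
    { toFun := fun f => (memLp_inner μ hφ hB f).toLp _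
      map_add' := fun f g => by
        rw [← MemLp.toLp_add]
        congr 1
        ext p
        simp [inner_add_right]
      map_smul' := fun r f => by
        rw [RingHom.id_apply, ← MemLp.toLp_const_smul]
        congr 1
        ext p
        simp [inner_smul_right] }
  have hΛ : (fun f : H => √(∫ p, inner ℝ (φ p) f ^ 2 ∂μ)) = (fun x => ‖x‖) ∘ Λ := by
    ext f
    rw [Function.comp_apply, norm_eq_sqrt_real_inner, L2.inner_def]
    congr 1
    refine integral_congr_ae ?_
    filter_upwards [(memLp_inner μ hφ hB f).coeFn_toLp] with p hp
    have : (Λ f : Z → ℝ) p = inner ℝ (φ p) f := hp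
    rw [this]
    simp [sq]
  rw [hΛ]
  exact (convexOn_norm convex_univ).comp_linearMap Λ

variable {y : Z → ℝ} {M : ℝ}

theorem integrable_smul_of_bound (hφ : StronglyMeasurable φ) (hB : ∀ p, ‖φ p‖ ≤ B)
    (hy : Measurable y) (hM : ∀ p, |y p| ≤ M) : Integrable (fun p => y p • φ p) μ :=
  .of_bound (hy.stronglyMeasurable.smul hφ).aestronglyMeasurable (M * B)
    (.of_forall fun p => by
      rw [norm_smul]
      exact mul_le_mul (hM p) (hB p) (norm_nonneg _) ((abs_nonneg _).trans (hM p)))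

theorem integrable_sq_of_bound (hy : Measurable y) (hM : ∀ p, |y p| ≤ M) :
    Integrable (fun p => y p ^ 2) μ :=
  .of_bound (hy.pow_const 2).aestronglyMeasurable (M ^ 2)
    (.of_forall fun p => by
      rw [norm_pow]
      exact pow_le_pow_left₀ (norm_nonneg _) (hM p) 2)

theorem integral_sub_inner_sq [CompleteSpace H] (hφ : StronglyMeasurable φ) (hB : ∀ p, ‖φ p‖ ≤ B)
    (hy : Measurable y) (hM : ∀ p, |y p| ≤ M) (f : H) :
    ∫ p, (y p - inner ℝ (φ p) f) ^ 2 ∂μ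
      = ∫ p, y p ^ 2 ∂μ - 2 * inner ℝ f (∫ p, y p • φ p ∂μ)
        + inner ℝ (tensorSq f) (∫ p, tensorSq (φ p) ∂μ) := by
  have h1 := integrable_sq_of_bound μ hy hM
  have h2 := integrable_smul_of_bound μ hφ hB hy hM
  have h3 := (memLp_inner μ hφ hB f).integrable_sq
  rw [← integral_inner_sq μ hφ hB, ← integral_inner h2, ← integral_const_mul,
    ← integral_sub h1 ((h2.const_inner f).const_mul 2),
    ← integral_add (f := fun p => y p ^ 2 - 2 * inner ℝ f (y p • φ p))
      (h1.sub ((h2.const_inner f).const_mul 2)) h3]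
  refine integral_congr_ae (.of_forall fun p => ?_)
  simp only [inner_smul_right, real_inner_comm (φ p) f]
  ring

theorem convexOn_integral_sub_inner_sq [CompleteSpace H] (hφ : StronglyMeasurable φ)
    (hB : ∀ p, ‖φ p‖ ≤ B) (hy : Measurable y) (hM : ∀ p, |y p| ≤ M) :
    ConvexOn ℝ univ fun f : H => ∫ p, (y p - inner ℝ (φ p) f) ^ 2 ∂μ := by
  have hsq : ConvexOn ℝ univ fun f : H => ∫ p, inner ℝ (φ p) f ^ 2 ∂μ := by
    have h := (convexOn_sqrt_integral_inner_sq μ hφ hB).pow (fun _ _ => Real.sqrt_nonneg _) 2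
    refine h.congr fun f _ => ?_
    exact Real.sq_sqrt (integral_nonneg fun p => sq_nonneg _)
  have hlin : ConvexOn ℝ univ fun f : H => -2 * inner ℝ (∫ p, y p • φ p ∂μ) f :=
    ((-2 : ℝ) • (innerₛₗ ℝ (∫ p, y p • φ p ∂μ))).convexOn convex_univ
  refine ((hsq.add hlin).add_const (∫ p, y p ^ 2 ∂μ)).congr fun f _ => ?_
  rw [integral_sub_inner_sq μ hφ hB hy hM, ← integral_inner_sq μ hφ hB, real_inner_comm]
  simp only [Pi.add_apply]
  ring

end TensorSquare

/-! ### Empirical measures -/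

section Empirical

variable {Z : Type*} [MeasurableSpace Z]

/-- The empirical measure of a sample. -/
def empMeasure {n : ℕ} (z : Fin n → Z) : Measure Z :=
  (n : NNReal)⁻¹ • ∑ i, Measure.dirac (z i)

/-- This includes `n = 0`, where the measure is zero; well-posedness of the empirical problem needs
only finiteness. -/
instance {n : ℕ} (z : Fin n → Z) : IsFiniteMeasure (empMeasure z) := by
  unfold empMeasure
  infer_instance

theorem isProbabilityMeasure_empMeasure {n : ℕ} (hn : 0 < n) (z : Fin n → Z) :
    IsProbabilityMeasure (empMeasure z) := by
  constructor
  have h : (n : NNReal) ≠ 0 := by exact_mod_cast hn.ne'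
  simp only [empMeasure, Measure.smul_apply, Measure.finsetSum_apply, measure_univ,
    Finset.sum_const, Finset.card_univ, Fintype.card_fin, nsmul_eq_mul, mul_one]
  rw [ENNReal.smul_def, smul_eq_mul, ENNReal.coe_inv h, ENNReal.coe_natCast]
  exact ENNReal.inv_mul_cancel (by exact_mod_cast hn.ne') (ENNReal.natCast_ne_top n)

theorem integral_empMeasure [MeasurableSingletonClass Z] {V : Type*} [NormedAddCommGroup V]
    [NormedSpace ℝ V] [CompleteSpace V] {n : ℕ} (z : Fin n → Z) (g : Z → V) :
    ∫ p, g p ∂(empMeasure z) = (n : ℝ)⁻¹ • ∑ i, g (z i) := by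
  rw [empMeasure, integral_smul_nnreal_measure,
    integral_finsetSum_measure fun i _ => integrable_dirac (by simp)]
  simp [NNReal.smul_def]

end Empirical

end DerivReg

end

noncomputable section

namespace DerivReg

/-! ### Well-posedness and stability in the measure -/

section WellPosed

variable {d : ℕ} {X : Set (EuclideanSpace ℝ (Fin d))} {Y : Set ℝ}
  {H : Type*} [NormedAddCommGroup H] [InnerProductSpace ℝ H] [CompleteSpace H] [RKHS ℝ H X ℝ]

variable (Y) in
/-- Point evaluations and partial derivatives on `H` are represented by bounded continuous maps
`X → H`, and the outputs are bounded. -/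
structure IsBoundedRepresentation (D : Fin d → X → H) (κ κ' M : ℝ) : Prop where
  continuous_kfun : Continuous (kfun H)
  norm_kfun_le : ∀ x, ‖kfun H x‖ ≤ κ
  continuous_deriv : ∀ a, Continuous (D a)
  norm_deriv_le : ∀ a x, ‖D a x‖ ≤ κ'
  pderiv_eq : ∀ a x (f : H), pderiv a f x = inner ℝ (D a x) f
  abs_output_le : ∀ y : Y, |(y : ℝ)| ≤ M

theorem risk_nonneg (μ : Measure (X × Y)) (f : X → ℝ) : 0 ≤ risk μ f :=
  integral_nonneg fun _ => sq_nonneg _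

theorem penalty_nonneg (μ : Measure X) (f : X → ℝ) : 0 ≤ penalty μ f :=
  Finset.sum_nonneg fun _ _ => Real.sqrt_nonneg _

theorem regRisk_eq {H : Type*} [NormedAddCommGroup H] [InnerProductSpace ℝ H] [RKHS ℝ H X ℝ]
    (μ : Measure (X × Y)) (c ν τ : ℝ) :
    regRisk H μ c ν τ
      = fun f : H => (risk μ f + τ * c * penalty μ.fst f) + τ * ν * ‖f‖ ^ 2 := by
  ext f
  rw [regRisk]
  ring

theorem stronglyMeasurable_comp_fst {V : Type*} [NormedAddCommGroup V] {g : X → V}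
    (hg : Continuous g) : StronglyMeasurable fun p : X × Y => g p.1 :=
  hg.stronglyMeasurable.comp_measurable measurable_fst

theorem measurable_output : Measurable fun p : X × Y => (p.2 : ℝ) :=
  measurable_subtype_coe.comp measurable_snd

/-- The vector `∫ y k_x dμ(x, y)`. -/
def meanVec (H : Type*) [NormedAddCommGroup H] [InnerProductSpace ℝ H] [CompleteSpace H]
    [RKHS ℝ H X ℝ] (μ : Measure (X × Y)) : H :=
  ∫ p, (p.2 : ℝ) • kfun H p.1 ∂μ

/-- The second moment `∫ g(x) ⊗ g(x) dμ(x, y)`. -/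
def secondMoment (g : X → H) (μ : Measure (X × Y)) :
    UniformSpace.Completion (TensorProduct ℝ H H) :=
  ∫ p, tensorSq (g p.1) ∂μ

variable {D : Fin d → X → H} {κ κ' M : ℝ} (μ : Measure (X × Y))

theorem risk_eq_integral_inner (f : H) :
    risk μ f = ∫ p, ((p.2 : ℝ) - inner ℝ (kfun H p.1) f) ^ 2 ∂μ := by
  simp only [risk, inner_kfun]

namespace IsBoundedRepresentation

theorem integral_pderiv_sq (h : IsBoundedRepresentation Y D κ κ' M) (a : Fin d) (f : H) :
    ∫ x, pderiv a f x ^ 2 ∂μ.fst = ∫ p, inner ℝ (D a p.1) f ^ 2 ∂μ := by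
  simp only [h.pderiv_eq]
  rw [Measure.fst, integral_map measurable_fst.aemeasurable]
  exact (((h.continuous_deriv a).inner continuous_const).pow 2).aestronglyMeasurable

variable [IsFiniteMeasure μ]

theorem risk_eq (h : IsBoundedRepresentation Y D κ κ' M) (f : H) :
    risk μ f = ∫ p, (p.2 : ℝ) ^ 2 ∂μ - 2 * inner ℝ f (meanVec H μ)
      + inner ℝ (tensorSq f) (secondMoment (kfun H) μ) := by
  rw [risk_eq_integral_inner]
  exact integral_sub_inner_sq μ (stronglyMeasurable_comp_fst h.continuous_kfun)
    (fun p => h.norm_kfun_le p.1) measurable_output (fun p => h.abs_output_le p.2) f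

theorem convexOn_risk (h : IsBoundedRepresentation Y D κ κ' M) :
    ConvexOn ℝ univ fun f : H => risk μ f := by
  simp_rw [risk_eq_integral_inner]
  exact convexOn_integral_sub_inner_sq μ (stronglyMeasurable_comp_fst h.continuous_kfun)
    (fun p => h.norm_kfun_le p.1) measurable_output (fun p => h.abs_output_le p.2)

theorem continuous_risk (h : IsBoundedRepresentation Y D κ κ' M) :
    Continuous fun f : H => risk μ f := by
  simp_rw [h.risk_eq μ]
  have := continuous_tensorSq (H := H)
  fun_prop

theorem penalty_eq (h : IsBoundedRepresentation Y D κ κ' M) (f : H) :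
    penalty μ.fst f = ∑ a, √(inner ℝ (tensorSq f) (secondMoment (D a) μ)) := by
  simp only [penalty, h.integral_pderiv_sq μ]
  refine Finset.sum_congr rfl fun a _ => ?_
  rw [integral_inner_sq μ (stronglyMeasurable_comp_fst (h.continuous_deriv a))
    (fun p => h.norm_deriv_le a p.1), secondMoment]

theorem convexOn_penalty (h : IsBoundedRepresentation Y D κ κ' M) :
    ConvexOn ℝ univ fun f : H => penalty μ.fst f := by
  simp only [penalty, h.integral_pderiv_sq μ]
  refine ⟨convex_univ, fun f _ g _ s t hs ht hst => ?_⟩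
  simp only [smul_eq_mul, Finset.mul_sum, ← Finset.sum_add_distrib]
  refine Finset.sum_le_sum fun a _ => ?_
  exact (convexOn_sqrt_integral_inner_sq μ (stronglyMeasurable_comp_fst (h.continuous_deriv a))
    (fun p => h.norm_deriv_le a p.1)).2 (mem_univ f) (mem_univ g) hs ht hst

theorem continuous_penalty (h : IsBoundedRepresentation Y D κ κ' M) :
    Continuous fun f : H => penalty μ.fst f := by
  simp_rw [h.penalty_eq μ]
  have := continuous_tensorSq (H := H)
  fun_prop

variable {c ν τ : ℝ}

theorem convexOn_risk_add_penalty (h : IsBoundedRepresentation Y D κ κ' M) (hc : 0 ≤ c)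
    (hτ : 0 ≤ τ) :
    ConvexOn ℝ univ fun f : H => risk μ f + τ * c * penalty μ.fst f :=
  (h.convexOn_risk μ).add ((h.convexOn_penalty μ).smul (mul_nonneg hτ hc))

theorem existsUnique_regRisk (h : IsBoundedRepresentation Y D κ κ' M) (hc : 0 ≤ c) (hν : 0 < ν)
    (hτ : 0 < τ) : ∃! f : H, f ∈ minimizers (regRisk H μ c ν τ) univ := by
  rw [regRisk_eq]
  refine existsUnique_minimizer (h.convexOn_risk_add_penalty μ hc hτ.le)
    ((h.continuous_risk μ).add ((h.continuous_penalty μ).const_mul _)) (fun f => ?_)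
    (mul_pos hτ hν) convex_univ isClosed_univ univ_nonempty
  exact add_nonneg (risk_nonneg _ _) (mul_nonneg (mul_nonneg hτ.le hc) (penalty_nonneg _ _))

theorem existsUnique_regularizer (h : IsBoundedRepresentation Y D κ κ' M) (hc : 0 ≤ c)
    (hν : 0 < ν) (hmin : (riskMinimizers H μ).Nonempty) :
    ∃! f : H, f ∈ minimizers (regularizer H μ c ν) (riskMinimizers H μ) :=
  existsUnique_minimizer ((h.convexOn_penalty μ).smul hc)
    ((h.continuous_penalty μ).const_mul c) (fun _ => mul_nonneg hc (penalty_nonneg _ _)) hν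
    (convex_minimizers (h.convexOn_risk μ)) (isClosed_minimizers (h.continuous_risk μ)) hmin

theorem fReg_mem (h : IsBoundedRepresentation Y D κ κ' M) (hc : 0 ≤ c) (hν : 0 < ν)
    (hτ : 0 < τ) : fReg H μ c ν τ ∈ minimizers (regRisk H μ c ν τ) univ :=
  argmin_mem (h.existsUnique_regRisk μ hc hν hτ)

theorem tendsto_fReg (h : IsBoundedRepresentation Y D κ κ' M) (hc : 0 ≤ c)
    (hν : 0 < ν) (hmin : (riskMinimizers H μ).Nonempty) :
    Tendsto (fReg H μ c ν) (𝓝[>] 0) (𝓝 (fDagger H μ c ν)) :=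
  tendsto_of_mem_minimizers_regularized (C := fun f : H => c * penalty μ.fst f)
    (h.convexOn_risk μ) (h.continuous_risk μ)
    ((h.convexOn_penalty μ).smul hc) ((h.continuous_penalty μ).const_mul c)
    (fun _ => mul_nonneg hc (penalty_nonneg _ _)) hν
    (argmin_mem (h.existsUnique_regularizer μ hc hν hmin))
    fun _ hτ => h.fReg_mem μ hc hν hτ

/-- Compare with `0`, whose penalty vanishes and whose risk is at most `M²`. -/
theorem norm_sq_le_of_mem_minimizers (h : IsBoundedRepresentation Y D κ κ' M)
    [IsProbabilityMeasure μ] (hc : 0 ≤ c) (hν : 0 < ν) (hτ : 0 < τ) {f : H}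
    (hf : f ∈ minimizers (regRisk H μ c ν τ) univ) : ‖f‖ ^ 2 ≤ M ^ 2 / (τ * ν) := by
  have h0 := hf.2 0 trivial
  rw [regRisk_eq] at h0
  have hrisk : risk μ (0 : H) ≤ M ^ 2 := by
    rw [h.risk_eq μ]
    have : ∫ p : X × Y, (p.2 : ℝ) ^ 2 ∂μ ≤ ∫ _, M ^ 2 ∂μ :=
      integral_mono (integrable_sq_of_bound μ measurable_output fun p => h.abs_output_le p.2)
        (integrable_const _) fun p => sq_le_sq' (abs_le.1 (h.abs_output_le p.2)).1
          (abs_le.1 (h.abs_output_le p.2)).2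
    simpa [tensorSq_zero] using this
  have hpen : penalty μ.fst (0 : H) = 0 := by
    rw [h.penalty_eq μ]
    simp [tensorSq_zero]
  have h1 := risk_nonneg μ (f : X → ℝ)
  have h2 := mul_nonneg (mul_nonneg hτ.le hc) (penalty_nonneg μ.fst (f : X → ℝ))
  rw [le_div_iff₀ (mul_pos hτ hν)]
  simp only [hpen, norm_zero] at h0
  linarith

theorem empRisk_eq {n : ℕ} (z : Fin n → X × Y) (f : X → ℝ) :
    empRisk z f = risk (empMeasure z) f := by
  rw [risk, integral_empMeasure, empRisk, one_div, smul_eq_mul]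

theorem empPenalty_eq (h : IsBoundedRepresentation Y D κ κ' M) {n : ℕ} (z : Fin n → X × Y)
    (f : H) : empPenalty z f = penalty (empMeasure z).fst f := by
  rw [empPenalty, penalty]
  refine Finset.sum_congr rfl fun a _ => ?_
  rw [h.integral_pderiv_sq (empMeasure z), integral_empMeasure, one_div, smul_eq_mul]
  simp only [h.pderiv_eq]

theorem regEmpRisk_eq (h : IsBoundedRepresentation Y D κ κ' M) {n : ℕ} (z : Fin n → X × Y) :
    regEmpRisk H z c ν τ = regRisk H (empMeasure z) c ν τ := by
  ext f
  rw [regEmpRisk, regRisk, empRisk_eq, h.empPenalty_eq]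

theorem fHat_eq (h : IsBoundedRepresentation Y D κ κ' M) {n : ℕ} (z : Fin n → X × Y) :
    fHat H z c ν τ = fReg H (empMeasure z) c ν τ := by
  rw [fHat, fReg, h.regEmpRisk_eq]

/-- Stability of the regularized risk minimizer under a change of the measure. -/
theorem norm_sub_sq_le (h : IsBoundedRepresentation Y D κ κ' M) (μ μ' : Measure (X × Y))
    [IsProbabilityMeasure μ] [IsProbabilityMeasure μ'] (hM : 0 ≤ M) (hc : 0 ≤ c) (hν : 0 < ν)
    (hτ : 0 < τ) :
    ‖fReg H μ' c ν τ - fReg H μ c ν τ‖ ^ 2 ≤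
      ‖meanVec H μ' - meanVec H μ‖ ^ 2 / (τ * ν) ^ 2
        + 2 * M ^ 2 * ‖secondMoment (kfun H) μ' - secondMoment (kfun H) μ‖ / (τ * ν) ^ 2
        + 2 * c * M * (∑ a, √‖secondMoment (D a) μ' - secondMoment (D a) μ‖)
          / (ν * √(τ * ν)) := by
  set f := fReg H μ c ν τ
  set g := fReg H μ' c ν τ
  have hf : f ∈ minimizers (regRisk H μ c ν τ) univ := h.fReg_mem μ hc hν hτ
  have hg : g ∈ minimizers (regRisk H μ' c ν τ) univ := h.fReg_mem μ' hc hν hτ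
  have hm : 0 < τ * ν := mul_pos hτ hν
  have hsm : 0 < √(τ * ν) := Real.sqrt_pos.2 hm
  have hsq : √(τ * ν) ^ 2 = τ * ν := Real.sq_sqrt hm.le
  have hfn := h.norm_sq_le_of_mem_minimizers μ hc hν hτ hf
  have hgn := h.norm_sq_le_of_mem_minimizers μ' hc hν hτ hg
  set R := M / √(τ * ν) with hR
  have hR2 : R ^ 2 = M ^ 2 / (τ * ν) := by rw [hR, div_pow, hsq]
  have hR0 : 0 ≤ R := by positivity
  rw [← hR2] at hfn hgn
  have hfR : ‖f‖ ≤ R := le_of_sq_le_sq hfn hR0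
  have hgR : ‖g‖ ≤ R := le_of_sq_le_sq hgn hR0
  rw [regRisk_eq] at hf hg
  -- In the sum of `e1` and `e2` the norm terms and `∫ y²` cancel, leaving only differences of
  -- moments and penalties.
  have e1 := mul_norm_sub_sq_le_of_mem_minimizers (h.convexOn_risk_add_penalty μ hc hτ.le)
    convex_univ hf (mem_univ g)
  have e2 := mul_norm_sub_sq_le_of_mem_minimizers (h.convexOn_risk_add_penalty μ' hc hτ.le)
    convex_univ hg (mem_univ f)
  rw [norm_sub_rev] at e2
  set Δ := ‖g - f‖
  set β := ‖meanVec H μ' - meanVec H μ‖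
  set θ := ‖secondMoment (kfun H) μ' - secondMoment (kfun H) μ‖
  set σ := ∑ a, √‖secondMoment (D a) μ' - secondMoment (D a) μ‖ with hσ
  have hpen : ∀ {u : H} {μ₁ μ₂ : Measure (X × Y)} [IsFiniteMeasure μ₁] [IsFiniteMeasure μ₂],
      ‖u‖ ≤ R → penalty μ₁.fst u - penalty μ₂.fst u
        ≤ R * ∑ a, √‖secondMoment (D a) μ₁ - secondMoment (D a) μ₂‖ := by
    intro u μ₁ μ₂ _ _ hu
    rw [h.penalty_eq μ₁, h.penalty_eq μ₂, ← Finset.sum_sub_distrib, Finset.mul_sum]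
    exact Finset.sum_le_sum fun a _ => sqrt_inner_tensorSq_sub_le u hu
  have p1 : penalty μ.fst g - penalty μ'.fst g ≤ R * σ := by
    have := hpen (μ₁ := μ) (μ₂ := μ') hgR
    simpa only [hσ, norm_sub_rev] using this
  have p2 : penalty μ'.fst f - penalty μ.fst f ≤ R * σ := hpen hfR
  have hquad : ∀ {u : H}, ‖u‖ ≤ R →
      |inner ℝ (tensorSq u) (secondMoment (kfun H) μ' - secondMoment (kfun H) μ)| ≤ R ^ 2 * θ := by
    intro u hu
    refine (abs_real_inner_le_norm _ _).trans ?_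
    gcongr
    exact norm_tensorSq_le hu
  have q1 := (abs_le.1 (hquad hgR)).1
  have q2 := (abs_le.1 (hquad hfR)).2
  have l1 : inner ℝ (g - f) (meanVec H μ' - meanVec H μ) ≤ Δ * β := real_inner_le_norm _ _
  simp only [inner_sub_left, inner_sub_right] at q1 q2 l1
  have r1 := h.risk_eq μ g
  have r2 := h.risk_eq μ f
  have r3 := h.risk_eq μ' g
  have r4 := h.risk_eq μ' f
  have hτc : 0 ≤ τ * c := mul_nonneg hτ.le hc
  have p3 := mul_le_mul_of_nonneg_left (add_le_add p1 p2) hτc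
  have main : 2 * (τ * ν * Δ ^ 2) ≤ 2 * (Δ * β) + 2 * (R ^ 2 * θ) + 2 * (τ * c * (R * σ)) := by
    linarith
  -- The linear term keeps a factor `Δ`, so half of the left side absorbs it and `β` enters squared.
  have amgm : 2 * (Δ * β) ≤ τ * ν * Δ ^ 2 + β ^ 2 / (τ * ν) := by
    have : 0 ≤ (τ * ν * Δ - β) ^ 2 / (τ * ν) := by positivity
    have e : (τ * ν * Δ - β) ^ 2 / (τ * ν) = τ * ν * Δ ^ 2 + β ^ 2 / (τ * ν) - 2 * (Δ * β) := by
      field_simp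
      ring
    linarith
  have fin : τ * ν * Δ ^ 2 ≤ β ^ 2 / (τ * ν) + 2 * (R ^ 2 * θ) + 2 * (τ * c * (R * σ)) := by
    linarith
  refine le_of_mul_le_mul_left (fin.trans_eq ?_) hm
  rw [hR2, hR]
  field_simp

end IsBoundedRepresentation

end WellPosed

end DerivReg

end

noncomputable section

namespace DerivReg

/-! ### Probabilistic bound and its limit -/

section Deviation

variable {d : ℕ} {X : Set (EuclideanSpace ℝ (Fin d))} {Y : Set ℝ}

theorem measure_secondMoment_gt_le {H : Type*} [NormedAddCommGroup H] [InnerProductSpace ℝ H]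
    {g : X → H} (hg : Continuous g) {B : ℝ} (hB : ∀ x, ‖g x‖ ≤ B)
    (ρ : Measure (X × Y)) [IsProbabilityMeasure ρ] {n : ℕ} (hn : 0 < n) {l : ℝ} (hl : 0 < l) :
    (Measure.pi fun _ : Fin n => ρ)
        {z | 2 * √2 * B ^ 2 * √l / √n < ‖secondMoment g (empMeasure z) - secondMoment g ρ‖}
      ≤ ENNReal.ofReal (2 * Real.exp (-l)) := by
  simp only [secondMoment, integral_empMeasure]
  exact measure_norm_mean_sub_integral_gt_le
    (continuous_tensorSq.comp_stronglyMeasurable (stronglyMeasurable_comp_fst hg))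
    (fun p => norm_tensorSq_le (hB p.1)) hn hl

variable {H : Type*} [NormedAddCommGroup H] [InnerProductSpace ℝ H] [CompleteSpace H] [RKHS ℝ H X ℝ]
  {D : Fin d → X → H} {κ κ' M : ℝ}

theorem IsBoundedRepresentation.measure_meanVec_gt_le (h : IsBoundedRepresentation Y D κ κ' M)
    (ρ : Measure (X × Y)) [IsProbabilityMeasure ρ] {n : ℕ} (hn : 0 < n) {l : ℝ} (hl : 0 < l) :
    (Measure.pi fun _ : Fin n => ρ)
        {z | 2 * √2 * (M * κ) * √l / √n < ‖meanVec H (empMeasure z) - meanVec H ρ‖}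
      ≤ ENNReal.ofReal (2 * Real.exp (-l)) := by
  simp only [meanVec, integral_empMeasure]
  refine measure_norm_mean_sub_integral_gt_le (ξ := fun p : X × Y => (p.2 : ℝ) • kfun H p.1)
    (measurable_output.stronglyMeasurable.smul (stronglyMeasurable_comp_fst h.continuous_kfun))
    (fun p => ?_) hn hl
  rw [norm_smul]
  exact mul_le_mul (h.abs_output_le p.2) (h.norm_kfun_le p.1) (norm_nonneg _)
    ((abs_nonneg _).trans (h.abs_output_le p.2))

theorem rpow_quarter_eq (n : ℕ) : (n : ℝ) ^ (1 / 4 : ℝ) = √√n := by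
  rw [Real.sqrt_eq_rpow, Real.sqrt_eq_rpow, ← Real.rpow_mul (Nat.cast_nonneg n)]
  norm_num

/-- The first and last terms of `A` suffice, using `1/n ≤ 1/√n` and `√L ≤ L`; the middle two are
slack, and the positive term `1/(√n τν)` makes the inequality strict. The sign of `κ'` is assumed
only if `d > 0`, since for `d = 0` nothing forces it. -/
theorem stability_bound_lt {ν c τ L β θ : ℝ} {σ : Fin d → ℝ} {n : ℕ} (hn : 0 < n) (hκ : 0 ≤ κ)
    (hκ' : Fin d → 0 ≤ κ') (hM : 0 < M) (hν : 0 < ν) (hc : c ≤ 2) (hτ : 0 < τ)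
    (hL : 1 ≤ L) (hβ0 : 0 ≤ β) (hβ : β ≤ 2 * √2 * (M * κ) * √L / √n)
    (hθ : θ ≤ 2 * √2 * κ ^ 2 * √L / √n) (hσ : ∀ a, σ a ≤ 2 * √2 * κ' ^ 2 * √L / √n) :
    β ^ 2 / (τ * ν) ^ 2 + 2 * M ^ 2 * θ / (τ * ν) ^ 2
        + 2 * c * M * (∑ a, √(σ a)) / (ν * √(τ * ν))
      < boundA d κ κ' M ν n τ * L := by
  have hn1 : (1 : ℝ) ≤ n := by exact_mod_cast hn
  rw [boundA, rpow_quarter_eq]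
  have hs : 1 ≤ √(n : ℝ) := Real.one_le_sqrt.2 hn1
  set s := √(n : ℝ)
  have hs0 : 0 < s := by linarith
  have hq : 0 < √s := Real.sqrt_pos.2 hs0
  have hqs : √s ^ 2 = s := Real.sq_sqrt hs0.le
  set q := √s
  have hr : 1 ≤ √L := Real.one_le_sqrt.2 hL
  have hrL : √L ^ 2 = L := Real.sq_sqrt (by linarith)
  set r := √L
  have hx : 1 ≤ √(2 : ℝ) := Real.one_le_sqrt.2 (by norm_num)
  have hx2 : √(2 : ℝ) ^ 2 = 2 := Real.sq_sqrt (by norm_num)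
  set x := √(2 : ℝ)
  have hm : 0 < τ * ν := mul_pos hτ hν
  have hsm : 0 < √(τ * ν) := Real.sqrt_pos.2 hm
  have hL0 : 0 < L := by linarith
  have hrL' : r ≤ L := by rw [← hrL]; nlinarith
  have hsum : ∑ a, √(σ a) ≤ d * (2 * x * κ' * L / q) := by
    refine (Finset.sum_le_card_nsmul _ _ (2 * x * κ' * L / q) fun a _ => ?_).trans_eq (by simp)
    have := hκ' a
    rw [Real.sqrt_le_iff]
    refine ⟨by positivity, (hσ a).trans ?_⟩
    rw [div_pow, hqs]
    gcongr
    have e : (2 * x * κ' * L) ^ 2 = (8 * L ^ 2) * κ' ^ 2 := by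
      rw [mul_pow, mul_pow, mul_pow, hx2]; ring
    have e' : 2 * x * κ' ^ 2 * r = (2 * x * r) * κ' ^ 2 := by ring
    rw [e, e']
    refine mul_le_mul_of_nonneg_right ?_ (sq_nonneg κ')
    have : x ≤ 2 := by nlinarith
    have : x * r ≤ 2 * L := by gcongr
    nlinarith
  have t1 : β ^ 2 / (τ * ν) ^ 2 ≤ 8 * (M ^ 2 * κ ^ 2 * L / (s * (τ * ν) ^ 2)) := by
    have : β ^ 2 ≤ 8 * (M ^ 2 * κ ^ 2 * L) / s := by
      calc β ^ 2 ≤ (2 * x * (M * κ) * r / s) ^ 2 := by gcongr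
        _ = 8 * (M ^ 2 * κ ^ 2 * L) / s ^ 2 := by
          rw [div_pow, mul_pow, mul_pow, mul_pow, mul_pow, hx2, hrL]; ring
        _ ≤ 8 * (M ^ 2 * κ ^ 2 * L) / s := by
          gcongr
          nlinarith
    calc β ^ 2 / (τ * ν) ^ 2 ≤ 8 * (M ^ 2 * κ ^ 2 * L) / s / (τ * ν) ^ 2 := by gcongr
      _ = _ := by field_simp
  have t2 : 2 * M ^ 2 * θ / (τ * ν) ^ 2 ≤ 4 * x * (M ^ 2 * κ ^ 2 * L / (s * (τ * ν) ^ 2)) := by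
    calc 2 * M ^ 2 * θ / (τ * ν) ^ 2
        ≤ 2 * M ^ 2 * (2 * x * κ ^ 2 * L / s) / (τ * ν) ^ 2 := by
          gcongr
          refine hθ.trans ?_
          gcongr
      _ = _ := by field_simp; ring
  have t3 : 2 * c * M * (∑ a, √(σ a)) / (ν * √(τ * ν))
      ≤ 8 * x * (M * (d * κ') * L / (q * ν * √(τ * ν))) := by
    calc 2 * c * M * (∑ a, √(σ a)) / (ν * √(τ * ν))
        ≤ 2 * 2 * M * (d * (2 * x * κ' * L / q)) / (ν * √(τ * ν)) := by
          have h0 : 0 ≤ ∑ a, √(σ a) := Finset.sum_nonneg fun _ _ => Real.sqrt_nonneg _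
          gcongr
      _ = _ := by field_simp; ring
  have p1 : 0 ≤ M ^ 2 * κ ^ 2 * L / (s * (τ * ν) ^ 2) := by positivity
  have p2 : 0 ≤ 4 * x * M * (4 * κ / (s * (τ * ν) * √(τ * ν))) * L := by positivity
  have p3 : 0 < 4 * x * M * (1 / (s * (τ * ν))) * L := by positivity
  have e : 4 * x * M * (4 * κ ^ 2 * M / (s * τ ^ 2 * ν ^ 2) + 4 * κ / (s * (τ * ν) * √(τ * ν))
        + 1 / (s * (τ * ν)) + 2 * d * κ' / (q * ν * √(τ * ν))) * L
      = 16 * x * (M ^ 2 * κ ^ 2 * L / (s * (τ * ν) ^ 2))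
        + 4 * x * M * (4 * κ / (s * (τ * ν) * √(τ * ν))) * L
        + 4 * x * M * (1 / (s * (τ * ν))) * L
        + 8 * x * (M * (d * κ') * L / (q * ν * √(τ * ν))) := by
    field_simp
    ring
  rw [e]
  -- The mean vector and the kernel moment contribute `8 + 4√2`, which fits into the available
  -- `16√2`.
  have p4 : 8 * (M ^ 2 * κ ^ 2 * L / (s * (τ * ν) ^ 2))
      ≤ 12 * x * (M ^ 2 * κ ^ 2 * L / (s * (τ * ν) ^ 2)) := by
    gcongr
    linarith
  linarith

theorem IsBoundedRepresentation.measure_fHat_lt (h : IsBoundedRepresentation Y D κ κ' M)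
    (ρ : Measure (X × Y)) [IsProbabilityMeasure ρ] {ν c τ : ℝ} (hM : 0 < M) (hc0 : 0 ≤ c)
    (hc : c ≤ 2) (hν : 0 < ν) (hτ : 0 < τ) {n : ℕ} (hn : 0 < n) {η : ℝ} (hη : 0 < η)
    (hη1 : η ≤ 1) :
    (Measure.pi fun _ : Fin n => ρ)
        {z | √(boundA d κ κ' M ν n τ) * √(Real.log ((6 + 2 * d) / η))
              + ‖fReg H ρ c ν τ - fDagger H ρ c ν‖ ≤ ‖fHat H z c ν τ - fDagger H ρ c ν‖}
      < ENNReal.ofReal η := by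
  have hX : Nonempty X := (nonempty_of_isProbabilityMeasure ρ).map Prod.fst
  have hκ : 0 ≤ κ := (norm_nonneg _).trans (h.norm_kfun_le hX.some)
  have hκ' : Fin d → 0 ≤ κ' := fun a => (norm_nonneg _).trans (h.norm_deriv_le a hX.some)
  have hd : (0 : ℝ) ≤ d := Nat.cast_nonneg d
  have harg : 6 ≤ (6 + 2 * (d : ℝ)) / η := by
    rw [le_div_iff₀ hη]
    nlinarith
  set L := Real.log ((6 + 2 * d) / η) with hLdef
  have hL : 1 ≤ L := by
    rw [hLdef, Real.le_log_iff_exp_le (by linarith)]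
    linarith [Real.exp_one_lt_d9]
  have hL0 : 0 < L := by linarith
  set P := Measure.pi fun _ : Fin n => ρ
  set B₁ := {z : Fin n → X × Y |
    2 * √2 * (M * κ) * √L / √n < ‖meanVec H (empMeasure z) - meanVec H ρ‖}
  set B₂ := {z : Fin n → X × Y | 2 * √2 * κ ^ 2 * √L / √n
    < ‖secondMoment (kfun H) (empMeasure z) - secondMoment (kfun H) ρ‖}
  set B₃ : Fin d → Set (Fin n → X × Y) := fun a => {z | 2 * √2 * κ' ^ 2 * √L / √n
    < ‖secondMoment (D a) (empMeasure z) - secondMoment (D a) ρ‖}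
  have hsub : {z : Fin n → X × Y | √(boundA d κ κ' M ν n τ) * √L
        + ‖fReg H ρ c ν τ - fDagger H ρ c ν‖ ≤ ‖fHat H z c ν τ - fDagger H ρ c ν‖}
      ⊆ B₁ ∪ B₂ ∪ ⋃ a, B₃ a := by
    intro z hz
    by_contra hnot
    simp only [mem_union, mem_iUnion, not_or, not_exists] at hnot
    obtain ⟨⟨h1, h2⟩, h3⟩ := hnot
    have := isProbabilityMeasure_empMeasure hn z
    have hstab := (h.norm_sub_sq_le (c := c) ρ (empMeasure z) hM.le hc0 hν hτ).trans_lt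
      (stability_bound_lt hn hκ hκ' hM hν hc hτ hL (norm_nonneg _)
        (not_lt.1 h1) (not_lt.1 h2) fun a => not_lt.1 (h3 a))
    rw [← h.fHat_eq] at hstab
    have hz' : √(boundA d κ κ' M ν n τ) * √L ≤ ‖fHat H z c ν τ - fReg H ρ c ν τ‖ := by
      have htri := norm_sub_le_norm_sub_add_norm_sub (fHat H z c ν τ) (fReg H ρ c ν τ)
        (fDagger H ρ c ν)
      have hz2 : √(boundA d κ κ' M ν n τ) * √L + ‖fReg H ρ c ν τ - fDagger H ρ c ν‖
        ≤ ‖fHat H z c ν τ - fDagger H ρ c ν‖ := hz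
      linarith
    rw [← Real.sqrt_mul' _ hL0.le] at hz'
    exact absurd hz' (not_le.2 (Real.lt_sqrt_of_sq_lt hstab))
  set p := 2 * Real.exp (-L) with hp
  -- The logarithm is calibrated for `3 + d` events but only `2 + d` occur, so the union bound is
  -- strictly below `η`.
  have hpv : p = η / (3 + d) := by
    rw [hp, hLdef, ← Real.log_inv, Real.exp_log (by positivity)]
    field_simp
    ring
  have hp0 : 0 ≤ p := by positivity
  calc P _ ≤ P (B₁ ∪ B₂ ∪ ⋃ a, B₃ a) := measure_mono hsub
    _ ≤ P B₁ + P B₂ + ∑ a, P (B₃ a) :=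
        (measure_union_le _ _).trans
          (add_le_add (measure_union_le _ _) (measure_iUnion_fintype_le _ _))
    _ ≤ ENNReal.ofReal p + ENNReal.ofReal p + ∑ _a : Fin d, ENNReal.ofReal p := by
        refine add_le_add (add_le_add (h.measure_meanVec_gt_le ρ hn hL0)
          (measure_secondMoment_gt_le h.continuous_kfun h.norm_kfun_le ρ hn hL0))
          (Finset.sum_le_sum fun a _ =>
            measure_secondMoment_gt_le (h.continuous_deriv a) (h.norm_deriv_le a) ρ hn hL0)
    _ = ENNReal.ofReal ((2 + d) * p) := by
        rw [← ENNReal.ofReal_sum_of_nonneg fun _ _ => hp0, ← ENNReal.ofReal_add hp0 hp0,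
          ← ENNReal.ofReal_add (by positivity) (by positivity)]
        congr 1
        simp
        ring
    _ < ENNReal.ofReal η := by
        rw [ENNReal.ofReal_lt_ofReal_iff hη, hpv, mul_div_assoc', div_lt_iff₀ (by positivity)]
        linarith

/-- With `w = (√n τ²)⁻¹`, the four terms are constant multiples of `w`, `w√τ`, `wτ` and `√w √τ`. -/
theorem tendsto_boundA (d : ℕ) (κ κ' M : ℝ) {ν : ℝ} (hν : 0 < ν) {τ : ℕ → ℝ} (hτ : ∀ n, 0 < τ n)
    (hτ0 : Tendsto τ atTop (𝓝 0)) (hw : Tendsto (fun n : ℕ => (√n * τ n ^ 2)⁻¹) atTop (𝓝 0)) :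
    Tendsto (fun n => boundA d κ κ' M ν n (τ n)) atTop (𝓝 0) := by
  have hsτ : Tendsto (fun n => √(τ n)) atTop (𝓝 0) := by simpa using hτ0.sqrt
  have hsw : Tendsto (fun n : ℕ => √(√n * τ n ^ 2)⁻¹) atTop (𝓝 0) := by simpa using hw.sqrt
  have hlim := ((((hw.const_mul (4 * κ ^ 2 * M / ν ^ 2)).add
    ((hw.mul hsτ).const_mul (4 * κ / (ν * √ν)))).add ((hw.mul hτ0).const_mul (1 / ν))).add
    ((hsw.mul hsτ).const_mul (2 * d * κ' / (ν * √ν)))).const_mul (4 * √2 * M)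
  simp only [mul_zero, add_zero] at hlim
  refine hlim.congr' ?_
  filter_upwards [eventually_gt_atTop 0] with n hn
  have hn' : (0 : ℝ) < n := by exact_mod_cast hn
  have hs : 0 < √(n : ℝ) := Real.sqrt_pos.2 hn'
  have hq : 0 < √√(n : ℝ) := Real.sqrt_pos.2 hs
  have ht := hτ n
  have hst : 0 < √(τ n) := Real.sqrt_pos.2 ht
  have hsν : 0 < √ν := Real.sqrt_pos.2 hν
  have hst2 : √(τ n) ^ 2 = τ n := Real.sq_sqrt ht.le
  have e1 : √(√n * τ n ^ 2)⁻¹ = (√√n * τ n)⁻¹ := by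
    rw [Real.sqrt_inv, Real.sqrt_mul hs.le, Real.sqrt_sq ht.le]
  rw [boundA, rpow_quarter_eq, Real.sqrt_mul ht.le, e1]
  set t := √(τ n)
  rw [← hst2]
  field_simp

end Deviation

end DerivReg

end

/-! ### The main theorem -/

theorem theorem4
    {d : ℕ} {X : Set (EuclideanSpace ℝ (Fin d))} {Y : Set ℝ}
    (hX : closure X = closure (interior X))
    (ρ : Measure (X × Y)) [IsProbabilityMeasure ρ]
    (H : Type*) [NormedAddCommGroup H] [InnerProductSpace ℝ H] [CompleteSpace H] [RKHS ℝ H X ℝ]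
    (κ κ' M ν c : ℝ)
    (hA1 : ∀ x : X, ‖kfun H x‖ ≤ κ)
    (hA2 : KernelC2 H)
    (hA2' : ∀ (a : Fin d) (x : X) (g : H), IsKernelDeriv a x g → ‖g‖ ≤ κ')
    (hM : 0 < M) (hA3 : Y ⊆ Icc (-M) M)
    (hν : 0 < ν) (hc : c = 1 ∨ c = 2)
    (hmin : (riskMinimizers H ρ).Nonempty) :
    -- the three minimization problems are well posed
    ((∃! f : H, f ∈ minimizers (regularizer H ρ c ν) (riskMinimizers H ρ)) ∧
      ∀ τ : ℝ, 0 < τ →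
        (∃! f : H, f ∈ minimizers (regRisk H ρ c ν τ) univ) ∧
        ∀ (n : ℕ) (z : Fin n → X × Y), ∃! f : H, f ∈ minimizers (regEmpRisk H z c ν τ) univ) ∧
    -- the probabilistic bound
    (∀ n : ℕ, 0 < n → ∀ τ : ℝ, 0 < τ → ∀ η : ℝ, 0 < η → η ≤ 1 →
      (Measure.pi fun _ : Fin n => ρ)
        {z | √(boundA d κ κ' M ν n τ) * √(Real.log ((6 + 2 * d) / η))
              + ‖fReg H ρ c ν τ - fDagger H ρ c ν‖ ≤ ‖fHat H z c ν τ - fDagger H ρ c ν‖}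
        < ENNReal.ofReal η) ∧
    -- convergence in probability in the norm of `H`
    (∀ τ : ℕ → ℝ, (∀ n, 0 < τ n) → Tendsto τ atTop (𝓝 0) →
      Tendsto (fun n : ℕ => (√n * τ n ^ 2)⁻¹) atTop (𝓝 0) →
      ∀ ε : ℝ, 0 < ε →
        Tendsto (fun n : ℕ => (Measure.pi fun _ : Fin n => ρ)
            {z | ε ≤ ‖fHat H z c ν (τ n) - fDagger H ρ c ν‖})
          atTop (𝓝 0)) := by
  obtain hcpos : 0 ≤ c := by rcases hc with rfl | rfl <;> norm_num
  have hc2 : c ≤ 2 := by rcases hc with rfl | rfl <;> norm_num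
  choose D hDc hD using exists_pderiv_representer H hX hA2
  have h : IsBoundedRepresentation Y D κ κ' M :=
    { continuous_kfun := continuous_kfun H hA2
      norm_kfun_le := hA1
      continuous_deriv := hDc
      norm_deriv_le := fun a => norm_pderiv_representer_le (hD a) (hA2' a)
      pderiv_eq := hD
      abs_output_le := fun y => abs_le.2 (hA3 y.2) }
  have hprob : ∀ n : ℕ, 0 < n → ∀ τ : ℝ, 0 < τ → ∀ η : ℝ, 0 < η → η ≤ 1 →
      (Measure.pi fun _ : Fin n => ρ)
        {z | √(boundA d κ κ' M ν n τ) * √(Real.log ((6 + 2 * d) / η))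
              + ‖fReg H ρ c ν τ - fDagger H ρ c ν‖ ≤ ‖fHat H z c ν τ - fDagger H ρ c ν‖}
        < ENNReal.ofReal η := fun n hn τ hτ η hη hη1 =>
    h.measure_fHat_lt ρ hM hcpos hc2 hν hτ hn hη hη1
  refine ⟨⟨h.existsUnique_regularizer ρ hcpos hν hmin, fun τ hτ =>
    ⟨h.existsUnique_regRisk ρ hcpos hν hτ, fun n z => ?_⟩⟩, hprob, ?_⟩
  · rw [h.regEmpRisk_eq]
    exact h.existsUnique_regRisk _ hcpos hν hτ
  · intro τ hτ hτ0 hw ε hε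
    rw [ENNReal.tendsto_nhds_zero]
    intro δ hδ
    have hmin1 : min δ 1 ≠ ⊤ := ne_top_of_le_ne_top ENNReal.one_ne_top (min_le_right _ _)
    -- With the confidence level fixed, the deviation threshold tends to zero and is eventually
    -- below `ε`. Truncation at `1` keeps `η` finite and admissible.
    set η := (min δ 1).toReal with hη
    have hη0 : 0 < η := ENNReal.toReal_pos (lt_min hδ one_pos).ne' hmin1
    have hη1 : η ≤ 1 := by
      simpa using ENNReal.toReal_mono ENNReal.one_ne_top (min_le_right δ 1)
    have hreg : Tendsto (fun n => ‖fReg H ρ c ν (τ n) - fDagger H ρ c ν‖) atTop (𝓝 0) :=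
      tendsto_iff_norm_sub_tendsto_zero.1 ((h.tendsto_fReg ρ hcpos hν hmin).comp
        (tendsto_nhdsWithin_iff.2 ⟨hτ0, .of_forall hτ⟩))
    have hlim := ((tendsto_boundA d κ κ' M hν hτ hτ0 hw).sqrt.mul_const
      √(Real.log ((6 + 2 * d) / η))).add hreg
    rw [Real.sqrt_zero, zero_mul, add_zero] at hlim
    filter_upwards [hlim.eventually (gt_mem_nhds hε), eventually_gt_atTop 0] with n hnε hn
    calc (Measure.pi fun _ : Fin n => ρ) {z | ε ≤ ‖fHat H z c ν (τ n) - fDagger H ρ c ν‖}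
        ≤ _ := measure_mono fun z (hz : ε ≤ _) => hnε.le.trans hz
      _ ≤ ENNReal.ofReal η := (hprob n hn (τ n) (hτ n) η hη0 hη1).le
      _ = min δ 1 := ENNReal.ofReal_toReal hmin1
      _ ≤ δ := min_le_left _ _
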